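/- An attack tree $T=(N,\mathrm{typ},\mathrm{ch})$ consists of a finite set $N$ of nodes, a type $\mathrm{typ}(v)\in\{\mathrm{BAS},\mathrm{OR},\mathrm{AND},\mathrm{SAND}\}$ and a finite sequence $\mathrm{ch}(v)$ of children (in $N$) for every $v\in N$, such that the graph with edges $v\to u$ for $u\in\mathrm{ch}(v)$ is a connected directed acyclic graph with a unique root $R_T$ (node without parents), and $\mathrm{typ}(v)=\mathrm{BAS}$ iff $\mathrm{ch}(v)$ is empty. The nodes of type BAS are the basic attack steps. $T$ is static if it has no SAND nodes. For $v\in N$, $T_v$ is the attack tree formed by $v$ and its descendants, with root $v$. *Static metric.* Let $T$ be static. A set $A$ of basic attack steps reaches a basic attack step $a$ iff $a\in A$, an OR node iff it reaches some child, and an AND node iff it reaches all children. A minimal attack is an inclusion-minimal set reaching $R_T$. For associative commutative operations $\triangledown,\vartriangle$ on a set $V$ and an attribution $\alpha:\mathrm{BAS}_T\to V$, the metric is $\check\alpha(T)=\triangledown_A\,\vartriangle_{a\in A}\alpha(a)$, with $A$ ranging over the minimal attacks. *Dynamic metric.* Let $T$ be any attack tree. An attack is a pair $O=(A,\prec)$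 of a set $A$ of basic attack steps and a strict partial order $\prec$ on $A$; $(A,\prec)\le(A',\prec')$ means $A\subseteq A'$ and ${\prec}\subseteq{\prec'}$. BAS, OR and AND nodes are reached as above; a SAND node with children $(v_1,\dots,v_n)$ is reached by $O$ iff all $v_i$ are reached and, for all $1\le i<n$, $a\prec a'$ for all $a\in A\cap T_{v_i}$ and $a'\in A\cap T_{v_{i+1}}$. $T$ is satisfiable if some attack reaches $R_T$; the minimal attacks are the $\le$-minimal attacks reaching $R_T$. A maximal chain of $O$ is a sequence in $A$ from a $\prec$-minimal to a $\prec$-maximal element in which each term is a direct successor of the previous one. For associative commutative operations $\triangledown,\vartriangle,\vartriangleright$ on $V$ and an attribution $\alpha:\mathrm{BAS}_T\to V$, the metric of a satisfiable $T$ is $\check\alpha(T)=\triangledown_O\,\vartriangle_C\,\vartriangleright_{a\in C}\alpha(a)$, with $O$ ranging over the minimal attacks of $T$ and $C$ over the maximal chains of $O$. *Modules.* A module of $T$ is a node $v$, not a basic attack step, which is the only node of $T_v$ that has a parent outside $T_v$ (if any node has); that is, every path from a node outside $T_v$ to a node of $T_v$ passes through $v$. Let $T^v$ be the attack tree obtained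 from $T$ by replacing $T_v$ by one new basic attack step $\tilde v$, and, given $\alpha$, let $\alpha^v$ be the attribution of $T^v$ with $\alpha^v(a)=\alpha(a)$ for $a\ne\tilde v$ and $\alpha^v(\tilde v)=\check\alpha(T_v)$ (with $\alpha$ restricted to $T_v$). **Theorem.** Let $v$ be a module of an attack tree $T$ and let $\alpha:\mathrm{BAS}_T\to V$ be an attribution. 1. If $T$ is static and $V$ is a semiring attribute domain ($\vartriangle$ distributes over $\triangledown$), then, for the static metrics, $\check\alpha(T)=\check{\alpha^v}(T^v)$. 2. If $T$ and $T_v$ are satisfiable and $V$ is a semiring dynamic attribute domain ($\vartriangleright$ distributes over $\vartriangle$ and $\triangledown$, and $\vartriangle$ distributes over $\triangledown$), then, for the dynamic metrics, $\check\alpha(T)=\check{\alpha^v}(T^v)$. In both cases all metrics involved are well defined (no operation is applied to an empty family). -/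

import Mathlib

universe u w

/-! ### Attack trees -/

/-- The node types of an attack tree. -/
inductive NodeType where
  | bas
  | or
  | and
  | sand

/-- An attack tree with (finite) node set `N`: a connected directed acyclic graph, given by the
sequence of children of each node, with a unique root, whose nodes carry a type, and whose leaves
are exactly the basic attack steps. -/
structure AttackTree (N : Type u) where
  typ : N → NodeType
  ch : N → List N
  acyclic : ∀ v, ¬ Relation.TransGen (fun x y => y ∈ ch x) v v
  connected : (SimpleGraph.fromRel (fun x y => y ∈ ch x)).Connected
  root : N
  root_no_parent : ∀ v, root ∉ ch v
  root_unique : ∀ r, (∀ v, r ∉ ch v) → r = root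
  bas_iff_leaf : ∀ v, typ v = NodeType.bas ↔ ch v = []

namespace AttackTree

variable {N : Type u}

/-- `T.Desc v x`: the node `x` is `v` or a descendant of `v`, i.e. `x` is a node of `T_v`. -/
def Desc (T : AttackTree N) (v x : N) : Prop :=
  Relation.ReflTransGen (fun a b => b ∈ T.ch a) v x

/-- The basic attack steps of `T`. -/
def Bas (T : AttackTree N) : Type u := {a : N // T.typ a = NodeType.bas}

instance (T : AttackTree N) [Finite N] : Finite T.Bas :=
  inferInstanceAs (Finite {a : N // T.typ a = NodeType.bas})

/-- A static attack tree has no `SAND` gates. -/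
def IsStatic (T : AttackTree N) : Prop := ∀ v, T.typ v ≠ NodeType.sand

theorem desc_root [Finite N] (T : AttackTree N) (x : N) : T.Desc T.root x := by
  let r : N → N → Prop := Relation.TransGen (fun a b => b ∈ T.ch a)
  have : IsTrans N r := ⟨fun _ _ _ h h' => h.trans h'⟩
  have : Std.Irrefl r := ⟨fun a => T.acyclic a⟩
  have wf : WellFounded r := Finite.wellFounded_of_trans_of_irrefl r
  induction x using wf.induction with
  | _ x ih =>
    by_cases hx : x = T.root
    · subst hx; exact Relation.ReflTransGen.refl
    · have : ∃ p, x ∈ T.ch p := by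
        by_contra! h
        exact hx (T.root_unique x h)
      obtain ⟨p, hp⟩ := this
      exact (ih p (Relation.TransGen.single hp)).tail hp

/-- In an acyclic graph, a node from which every node can be reached is the unique root, and the
graph is connected. -/
def ofReachable (typ : N → NodeType) (ch : N → List N) (root : N)
    (acyclic : ∀ v, ¬ Relation.TransGen (fun x y => y ∈ ch x) v v)
    (reach : ∀ x, Relation.ReflTransGen (fun a b => b ∈ ch a) root x)
    (bas_iff_leaf : ∀ v, typ v = NodeType.bas ↔ ch v = []) : AttackTree N where
  typ := typ
  ch := ch
  acyclic := acyclic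
  connected := by
    have key : ∀ x, (SimpleGraph.fromRel (fun x y => y ∈ ch x)).Reachable root x := by
      intro x
      induction reach x with
      | refl => exact SimpleGraph.Reachable.refl _
      | @tail b c _ hbc ih =>
        refine ih.trans (SimpleGraph.Adj.reachable ?_)
        rw [SimpleGraph.fromRel_adj]
        refine ⟨?_, Or.inl hbc⟩
        rintro rfl
        exact acyclic _ (Relation.TransGen.single hbc)
    have : Nonempty N := ⟨root⟩
    exact ⟨fun x y => (key x).symm.trans (key y)⟩
  root := root
  root_no_parent := fun v hv =>
    acyclic root (Relation.TransGen.tail' (reach v) hv)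
  root_unique := by
    intro r hr
    rcases Relation.ReflTransGen.cases_tail (reach r) with h | ⟨p, _, hp⟩
    · exact h
    · exact absurd hp (hr p)
  bas_iff_leaf := bas_iff_leaf

/-! ### Sub-DAGs, modules and the replacement of a sub-DAG by a new basic attack step -/

theorem Desc.child {T : AttackTree N} {v x y : N} (h : T.Desc v x) (hy : y ∈ T.ch x) :
    T.Desc v y :=
  Relation.ReflTransGen.tail h hy

/-- The children of a node of `T_v`. -/
def subCh (T : AttackTree N) (v : N) (x : {x : N // T.Desc v x}) : List {x : N // T.Desc v x} :=
  (T.ch x.1).attachWith (T.Desc v) (fun _ hy => x.2.child hy)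

theorem mem_subCh (T : AttackTree N) (v : N) (x y : {x : N // T.Desc v x}) :
    y ∈ T.subCh v x ↔ y.1 ∈ T.ch x.1 := by
  simp [subCh, List.mem_attachWith]

/-- The attack tree `T_v`: all descendants of `v`, with `v` as the root. -/
def sub (T : AttackTree N) (v : N) : AttackTree {x : N // T.Desc v x} :=
  ofReachable (fun x => T.typ x.1) (T.subCh v) ⟨v, Relation.ReflTransGen.refl⟩
    (by
      intro x hx
      have key : ∀ y, Relation.TransGen (fun a b => b ∈ T.subCh v a) x y →
          Relation.TransGen (fun a b => b ∈ T.ch a) x.1 y.1 := by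
        intro y hy
        induction hy with
        | single h => exact Relation.TransGen.single ((T.mem_subCh v _ _).1 h)
        | tail _ h ih => exact ih.tail ((T.mem_subCh v _ _).1 h)
      exact T.acyclic x.1 (key x hx))
    (by
      rintro ⟨x, hx⟩
      induction hx with
      | refl => exact Relation.ReflTransGen.refl
      | @tail b c hb hbc ih => exact ih.tail ((T.mem_subCh v ⟨b, hb⟩ ⟨c, _⟩).2 hbc))
    (by
      intro x
      rw [T.bas_iff_leaf, subCh, List.attachWith_eq_nil_iff])

/-- A module is an inner node `v` that is the only node of `T_v` with parents outside `T_v`;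
equivalently, every path from a node outside `T_v` to a node of `T_v` passes through `v`. -/
def IsModule (T : AttackTree N) (v : N) : Prop :=
  T.typ v ≠ NodeType.bas ∧
    ∀ p x, ¬ T.Desc v p → T.Desc v x → x ∈ T.ch p → x = v

open Classical in
/-- The projection of nodes of `T` to nodes of `T^v`: the nodes outside `T_v` are kept, and `T_v`
is sent to the new node `none`. -/
noncomputable def proj (T : AttackTree N) (v x : N) : Option {x : N // ¬ T.Desc v x} :=
  if h : T.Desc v x then none else some ⟨x, h⟩

/-- The type of a node of `T^v`. -/
def replaceTyp (T : AttackTree N) (v : N) : Option {x : N // ¬ T.Desc v x} → NodeType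
  | none => NodeType.bas
  | some x => T.typ x.1

/-- The children of a node of `T^v`. -/
noncomputable def replaceCh (T : AttackTree N) (v : N) :
    Option {x : N // ¬ T.Desc v x} → List (Option {x : N // ¬ T.Desc v x})
  | none => []
  | some x => (T.ch x.1).map (T.proj v)

theorem proj_eq_some (T : AttackTree N) (v x : N) (y : {x : N // ¬ T.Desc v x})
    (h : T.proj v x = some y) : x = y.1 := by
  unfold proj at h
  split_ifs at h
  exact congrArg Subtype.val (Option.some.inj h)

theorem replace_acyclic (T : AttackTree N) (v : N) (z : Option {x : N // ¬ T.Desc v x}) :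
    ¬ Relation.TransGen (fun x y => y ∈ T.replaceCh v x) z z := by
  have key : ∀ z z' : Option {x : N // ¬ T.Desc v x},
      Relation.TransGen (fun x y => y ∈ T.replaceCh v x) z z' → ∀ y', z' = some y' →
      ∃ y, z = some y ∧ Relation.TransGen (fun a b => b ∈ T.ch a) y.1 y'.1 := by
    intro z z' h
    induction h using Relation.TransGen.head_induction_on with
    | @single a h =>
      rintro y' rfl
      cases a with
      | none => simp [replaceCh] at h
      | some y =>
        simp only [replaceCh, List.mem_map] at h
        obtain ⟨x, hx, hxy⟩ := h
        have := T.proj_eq_some v x y' hxy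
        subst this
        exact ⟨y, rfl, Relation.TransGen.single hx⟩
    | @head a c h _ ih =>
      intro y' hy'
      obtain ⟨y, rfl, hy⟩ := ih y' hy'
      cases a with
      | none => simp [replaceCh] at h
      | some y₀ =>
        simp only [replaceCh, List.mem_map] at h
        obtain ⟨x, hx, hxy⟩ := h
        have := T.proj_eq_some v x y hxy
        subst this
        exact ⟨y₀, rfl, Relation.TransGen.head hx hy⟩
  intro h
  cases z with
  | none =>
    rcases Relation.TransGen.head'_iff.1 h with ⟨c, hc, _⟩
    simp [replaceCh] at hc
  | some y =>
    obtain ⟨y', hy', hcyc⟩ := key _ _ h y rfl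
    obtain rfl := Option.some.inj hy'
    exact T.acyclic _ hcyc

theorem replace_reach [Finite N] (T : AttackTree N) (v : N)
    (z : Option {x : N // ¬ T.Desc v x}) :
    Relation.ReflTransGen (fun x y => y ∈ T.replaceCh v x) (T.proj v T.root) z := by
  have key : ∀ x, Relation.ReflTransGen (fun x y => y ∈ T.replaceCh v x)
      (T.proj v T.root) (T.proj v x) := by
    intro x
    induction T.desc_root x with
    | refl => exact Relation.ReflTransGen.refl
    | @tail b c _ hbc ih =>
      by_cases hb : T.Desc v b
      · have hc : T.Desc v c := Relation.ReflTransGen.tail hb hbc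
        have : T.proj v c = T.proj v b := by simp [proj, hb, hc]
        rw [this]; exact ih
      · refine ih.tail ?_
        have : T.proj v b = some ⟨b, hb⟩ := by simp [proj, hb]
        rw [this]
        exact List.mem_map.2 ⟨c, hbc, rfl⟩
  cases z with
  | none =>
    have : T.proj v v = none := by simp [proj, Desc, Relation.ReflTransGen.refl]
    rw [← this]; exact key v
  | some y =>
    have : T.proj v y.1 = some y := by simp [proj, y.2]
    rw [← this]; exact key y.1

/-- The attack tree `T^v` obtained by replacing `T_v` by a single new basic attack step, the node
`none`; edges into `T_v` become edges into the new node. -/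
noncomputable def replace [Finite N] (T : AttackTree N) (v : N) :
    AttackTree (Option {x : N // ¬ T.Desc v x}) :=
  ofReachable (T.replaceTyp v) (T.replaceCh v) (T.proj v T.root)
    (T.replace_acyclic v) (T.replace_reach v)
    (by
      intro z
      cases z with
      | none => simp [replaceTyp, replaceCh]
      | some x => simp [replaceTyp, replaceCh, T.bas_iff_leaf])

variable {V : Type w}

/-- The restriction of an attribution to `T_v`. -/
def subAttr (T : AttackTree N) (v : N) (α : T.Bas → V) : (T.sub v).Bas → V :=
  fun a => α ⟨a.1.1, a.2⟩

/-- The attribution of `T^v` that agrees with `α` outside `T_v` and has the value `x` at the new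
basic attack step. -/
def replaceAttr [Finite N] (T : AttackTree N) (v : N) (α : T.Bas → V) (x : V) :
    (T.replace v).Bas → V
  | ⟨none, _⟩ => x
  | ⟨some y, h⟩ => α ⟨y.1, h⟩

end AttackTree

/-! ### Attribute domains -/

/-- An attribute domain over `V`: associative and commutative operators. -/
structure AttributeDomain (V : Type w) where
  disj : V → V → V
  conj : V → V → V
  disj_comm : Std.Commutative disj
  disj_assoc : Std.Associative disj
  conj_comm : Std.Commutative conj
  conj_assoc : Std.Associative conj

attribute [instance] AttributeDomain.disj_comm AttributeDomain.disj_assoc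
  AttributeDomain.conj_comm AttributeDomain.conj_assoc

/-- A semiring attribute domain: `conj` distributes over `disj`. -/
def AttributeDomain.IsSemiring {V : Type w} (D : AttributeDomain V) : Prop :=
  ∀ x y z, D.conj x (D.disj y z) = D.disj (D.conj x y) (D.conj x z)

/-- A dynamic attribute domain has an additional associative and commutative operator, `seq`. -/
structure DynamicAttributeDomain (V : Type w) extends AttributeDomain V where
  seq : V → V → V
  seq_comm : Std.Commutative seq
  seq_assoc : Std.Associative seq

attribute [instance] DynamicAttributeDomain.seq_comm DynamicAttributeDomain.seq_assoc

/-- A semiring dynamic attribute domain: `seq` distributes over `conj` and `disj`, and `conj`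
distributes over `disj`. -/
def DynamicAttributeDomain.IsSemiring {V : Type w} (D : DynamicAttributeDomain V) : Prop :=
  (∀ x y z, D.seq x (D.conj y z) = D.conj (D.seq x y) (D.seq x z)) ∧
  (∀ x y z, D.seq x (D.disj y z) = D.disj (D.seq x y) (D.seq x z)) ∧
  (∀ x y z, D.conj x (D.disj y z) = D.disj (D.conj x y) (D.conj x z))

/-- The combination by `op` of the values `f i`, for `i` in `S`. As `op` need not have a neutral
element, the result is `none` (undefined) when there is nothing to combine. -/
noncomputable def bigOp {ι : Type u} [Finite ι] {V : Type w} (op : V → V → V)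
    [Std.Commutative op] [Std.Associative op] (S : Set ι) (f : ι → Option V) : Option V :=
  (Set.toFinite S).toFinset.fold (Option.merge op) none f

/-! ### Static attack trees: semantics and metric -/

namespace AttackTree

variable {N : Type u} {V : Type w}

/-- The structure function of a static attack tree: the attack `A` reaches the node `v`. -/
inductive StaticReach (T : AttackTree N) (A : Set T.Bas) : N → Prop
  | bas (a : T.Bas) : a ∈ A → StaticReach T A a.1
  | or (v x : N) : T.typ v = NodeType.or → x ∈ T.ch v → StaticReach T A x → StaticReach T A v
  | and (v : N) : T.typ v = NodeType.and → (∀ x ∈ T.ch v, StaticReach T A x) →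
      StaticReach T A v

/-- The minimal attacks of a static attack tree. -/
def staticMinAttacks (T : AttackTree N) : Set (Set T.Bas) :=
  {A | Minimal (fun A' => T.StaticReach A' T.root) A}

/-- The metric of a static attack tree. -/
noncomputable def staticMetric [Finite N] (T : AttackTree N) (D : AttributeDomain V)
    (α : T.Bas → V) : Option V :=
  bigOp D.disj T.staticMinAttacks fun A => bigOp D.conj A fun a => some (α a)

/-! ### Dynamic attack trees: semantics and metric -/

/-- An attack on a dynamic attack tree: a set of basic attack steps with a strict partial order
on it. -/
@[ext]
structure Attack (T : AttackTree N) where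
  carrier : Set T.Bas
  prec : T.Bas → T.Bas → Prop
  mem_of_prec : ∀ a b, prec a b → a ∈ carrier ∧ b ∈ carrier
  irrefl : ∀ a, ¬ prec a a
  trans : ∀ a b c, prec a b → prec b c → prec a c

instance (T : AttackTree N) : PartialOrder T.Attack where
  le := fun O O' => O.carrier ⊆ O'.carrier ∧ ∀ a b, O.prec a b → O'.prec a b
  le_refl _ := ⟨subset_rfl, fun _ _ h => h⟩
  le_trans _ _ _ h h' := ⟨h.1.trans h'.1, fun a b hab => h'.2 a b (h.2 a b hab)⟩
  le_antisymm _ _ h h' := Attack.ext (h.1.antisymm h'.1)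
    (funext fun a => funext fun b => propext ⟨h.2 a b, h'.2 a b⟩)

instance (T : AttackTree N) [Finite N] : Finite T.Attack :=
  Finite.of_injective
    (fun O : T.Attack => ((O.carrier, O.prec) : Set T.Bas × (T.Bas → T.Bas → Prop)))
    (fun _ _ h => Attack.ext (congrArg Prod.fst h) (congrArg Prod.snd h))

/-- The structure function of a dynamic attack tree: the attack `O` reaches the node `v`. A gate
`SAND(v₁, …, vₙ)` is reached if all its children are, and all attack steps of `O` below `vᵢ`
precede all attack steps of `O` below `vᵢ₊₁`; a basic attack step is below itself. -/
inductive Reach (T : AttackTree N) (O : T.Attack) : N → Prop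
  | bas (a : T.Bas) : a ∈ O.carrier → Reach T O a.1
  | or (v x : N) : T.typ v = NodeType.or → x ∈ T.ch v → Reach T O x → Reach T O v
  | and (v : N) : T.typ v = NodeType.and → (∀ x ∈ T.ch v, Reach T O x) → Reach T O v
  | sand (v : N) : T.typ v = NodeType.sand → (∀ x ∈ T.ch v, Reach T O x) →
      (∀ (i : ℕ) (hi : i + 1 < (T.ch v).length), ∀ a ∈ O.carrier, ∀ b ∈ O.carrier,
        T.Desc (T.ch v)[i] a.1 → T.Desc (T.ch v)[i + 1] b.1 → O.prec a b) →
      Reach T O v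

/-- A tree is satisfiable if it has a successful attack. -/
def Satisfiable (T : AttackTree N) : Prop := ∃ O : T.Attack, T.Reach O T.root

/-- The minimal (successful) attacks of a dynamic attack tree. -/
def minAttacks (T : AttackTree N) : Set T.Attack :=
  {O | Minimal (fun O' => T.Reach O' T.root) O}

/-- `b` is a direct successor of `a` in the poset `O`. -/
def Attack.DirectSucc {T : AttackTree N} (O : T.Attack) (a b : T.Bas) : Prop :=
  O.prec a b ∧ ∀ c, ¬ (O.prec a c ∧ O.prec c b)

/-- The maximal chains of the poset `O`: sequences `(a₁, …, aₙ)` in `O` (with `n ≥ 1`), where `a₁`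
is minimal, `aₙ` is maximal, and each `aᵢ₊₁` is a direct successor of `aᵢ`. Such a sequence is
determined by its set of members, which is how it is recorded. -/
def Attack.maxChains {T : AttackTree N} (O : T.Attack) : Set (Set T.Bas) :=
  {C | ∃ (l : List T.Bas) (hl : l ≠ []), C = {a | a ∈ l} ∧ C ⊆ O.carrier ∧
    (∀ b, ¬ O.prec b (l.head hl)) ∧ (∀ b, ¬ O.prec (l.getLast hl) b) ∧
    l.IsChain O.DirectSucc}

/-- The metric of a dynamic attack tree. -/
noncomputable def metric [Finite N] (T : AttackTree N) (D : DynamicAttributeDomain V)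
    (α : T.Bas → V) : Option V :=
  bigOp D.disj T.minAttacks fun O =>
    bigOp D.conj O.maxChains fun C =>
      bigOp D.seq C fun a => some (α a)

end AttackTree

/-! ### Combining finite families -/

/-! An attack on `T` splits into an outer part on `T^v`, where all steps below `v` are merged into
one (`contract`), and an inner part on `T_v` (`inside`); conversely `subst P Q` puts the poset `Q`
in place of the new step of `P`. Because `v` is a module, gates outside `T_v` see `T_v` only through
`v`, and a SAND gate outside treats the steps below `v` as one block. Hence an attack that reaches
`v` whenever it uses a step below `v` reaches the root of `T` iff its contraction reaches the root
of `T^v` (`reach_root_contract_iff`). A minimal attack has this property, since steps below an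
unreached module can be dropped.

It follows (`mem_minAttacks_iff`) that the minimal attacks of `T` are exactly the `P.subst Q` with
`P` minimal for `T^v` and `Q` minimal for `T_v`, or `Q = ⊥` if `P` does not use the new step. The
pair is unique, so the combination over minimal attacks becomes a double one (`bigOp_minAttacks`).

For the dynamic metric, the maximal chains of `P.subst Q` are those of `P` with the new step
replaced by a maximal chain of `Q` (`mem_maxChains_subst_iff`). As `seq` distributes over `conj`,
the value of `P.subst Q` is the value of `P` with the value of `Q` at the new step (`value_subst`).
As a function of the attribute `x` of the new step, the value of `P` has the form `conj c (seq d x)`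
(`exists_value_replaceAttr_eq`), so `disj` over all `Q` can be moved inside. For the static metric,
minimal attacks carry the empty order, the same decomposition applies, and only `conj` over `disj`
is needed.

The operations have no neutral elements. Values are therefore taken in `Option V`, where `none` is a
unit for every `Option.merge op`; distributivity then requires nonempty families of defined values.
-/

theorem optionMerge_comm {V : Type w} (op : V → V → V) [Std.Commutative op] (x y : Option V) : Option.merge op x y = Option.merge op y x :=
  Std.Commutative.comm (op := Option.merge op) x y

section BigOp

variable {V : Type w}

/-- `Option V` as a commutative monoid under `Option.merge op`, with unit `none`. -/
@[reducible]
def optionMergeMonoid (op : V → V → V) [Std.Commutative op] [Std.Associative op] :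
    CommMonoid (Option V) where
  mul := Option.merge op
  one := none
  mul_assoc := Std.Associative.assoc (op := Option.merge op)
  mul_comm := Std.Commutative.comm (op := Option.merge op)
  one_mul x := by cases x <;> rfl
  mul_one x := by cases x <;> rfl

variable {ι : Type*} {κ : Type*} [Finite ι] [Finite κ]
  (op : V → V → V) [Std.Commutative op] [Std.Associative op]

/-- Makes the lemmas on `Finset.prod` available for `bigOp`. -/
theorem bigOp_eq_prod (S : Set ι) (f : ι → Option V) :
    bigOp op S f =
      letI := optionMergeMonoid op
      ∏ i ∈ (Set.toFinite S).toFinset, f i := by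
  rfl

theorem bigOp_congr {S : Set ι} {f g : ι → Option V} (h : ∀ i ∈ S, f i = g i) :
    bigOp op S f = bigOp op S g := by
  rw [bigOp_eq_prod, bigOp_eq_prod]
  let := optionMergeMonoid op
  exact Finset.prod_congr rfl fun i hi => h i (by simpa using hi)

@[simp]
theorem bigOp_empty (f : ι → Option V) : bigOp op ∅ f = none := by
  simp [bigOp]

@[simp]
theorem bigOp_singleton (i : ι) (f : ι → Option V) : bigOp op {i} f = f i := by
  have h : (Set.toFinite {i}).toFinset = {i} := by ext; simp
  rw [bigOp_eq_prod, h]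
  let := optionMergeMonoid op
  exact Finset.prod_singleton f i

theorem bigOp_union {S S' : Set ι} (h : Disjoint S S') (f : ι → Option V) :
    bigOp op (S ∪ S') f = Option.merge op (bigOp op S f) (bigOp op S' f) := by
  classical
  have hU : (Set.toFinite (S ∪ S')).toFinset =
      (Set.toFinite S).toFinset ∪ (Set.toFinite S').toFinset := by ext; simp
  rw [bigOp_eq_prod, bigOp_eq_prod, bigOp_eq_prod, hU]
  let := optionMergeMonoid op
  exact Finset.prod_union (by simpa using h)

theorem bigOp_insert {S : Set ι} {i : ι} (h : i ∉ S) (f : ι → Option V) :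
    bigOp op (insert i S) f = Option.merge op (f i) (bigOp op S f) := by
  rw [Set.insert_eq, bigOp_union op (Set.disjoint_singleton_left.2 h), bigOp_singleton]

theorem bigOp_image {S : Set ι} {g : ι → κ} (h : Set.InjOn g S) (f : κ → Option V) :
    bigOp op (g '' S) f = bigOp op S fun i => f (g i) := by
  classical
  have hI : (Set.toFinite (g '' S)).toFinset = (Set.toFinite S).toFinset.image g := by ext; simp
  rw [bigOp_eq_prod, bigOp_eq_prod, hI]
  let := optionMergeMonoid op
  exact Finset.prod_image (by simpa using h)

theorem bigOp_fiberwise {S : Set ι} {S' : Set κ} {g : ι → κ} (h : Set.MapsTo g S S')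
    (f : ι → Option V) :
    bigOp op S f = bigOp op S' fun j => bigOp op {i | i ∈ S ∧ g i = j} f := by
  classical
  have hF : ∀ j, (Set.toFinite {i | i ∈ S ∧ g i = j}).toFinset =
      (Set.toFinite S).toFinset.filter fun i => g i = j := by intro j; ext; simp
  simp only [bigOp_eq_prod, hF]
  let := optionMergeMonoid op
  exact (Finset.prod_fiberwise_of_maps_to (fun i hi => by simpa using h (by simpa using hi)) f).symm

theorem exists_bigOp_eq_some {S : Set ι} (hS : S.Nonempty) {f : ι → Option V}
    (hf : ∀ i ∈ S, ∃ x, f i = some x) : ∃ x, bigOp op S f = some x := by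
  induction S, Set.toFinite S using Set.Finite.induction_on with
  | empty => simp at hS
  | @insert i S hi _ ih =>
    obtain ⟨x, hx⟩ := hf i (by simp)
    rw [bigOp_insert op hi, hx]
    rcases S.eq_empty_or_nonempty with rfl | hne
    · exact ⟨x, by simp [Option.merge]⟩
    · obtain ⟨y, hy⟩ := ih hne fun j hj => hf j (by simp [hj])
      exact ⟨op x y, by simp [hy, Option.merge]⟩

/-- An operation distributes over a nonempty family of defined values. -/
theorem merge_bigOp {op' : V → V → V} (hd : ∀ x y z, op' x (op y z) = op (op' x y) (op' x z))
    (c : Option V) {S : Set ι} (hS : S.Nonempty) {f : ι → Option V}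
    (hf : ∀ i ∈ S, ∃ x, f i = some x) :
    Option.merge op' c (bigOp op S f) = bigOp op S fun i => Option.merge op' c (f i) := by
  induction S, Set.toFinite S using Set.Finite.induction_on with
  | empty => simp at hS
  | @insert i S hi _ ih =>
    rw [bigOp_insert op hi, bigOp_insert op hi]
    obtain ⟨x, hx⟩ := hf i (by simp)
    -- Since `none` is a unit for both operations, distributivity can fail at `none`; the
    -- one-element family is the base case.
    rcases S.eq_empty_or_nonempty with rfl | hne
    · cases c <;> simp [hx, Option.merge]
    · have hf' : ∀ j ∈ S, ∃ x, f j = some x := fun j hj => hf j (by simp [hj])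
      obtain ⟨y, hy⟩ := exists_bigOp_eq_some op hne hf'
      rw [← ih hne hf', hx, hy]
      cases c <;> simp [Option.merge, hd]

end BigOp

namespace AttackTree

variable {N : Type u}

/-! ### Reachability -/

theorem wellFounded_child [Finite N] (T : AttackTree N) :
    WellFounded (fun y x => y ∈ T.ch x) := by
  let r : N → N → Prop := fun y x => Relation.TransGen (fun a b => b ∈ T.ch a) x y
  have : IsTrans N r := ⟨fun _ _ _ h h' => h'.trans h⟩
  have : Std.Irrefl r := ⟨fun a => T.acyclic a⟩
  have wf : WellFounded r := Finite.wellFounded_of_trans_of_irrefl r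
  exact Subrelation.wf (fun h => Relation.TransGen.single h) wf

section Reach

variable {T : AttackTree N} {O : T.Attack} {x : N}

theorem reach_iff_of_bas (h : T.typ x = NodeType.bas) :
    T.Reach O x ↔ (⟨x, h⟩ : T.Bas) ∈ O.carrier := by
  constructor
  · intro hx
    cases hx with
    | bas a ha => exact ha
    | or _ y h' => exact absurd (h.symm.trans h') (by simp)
    | and _ h' => exact absurd (h.symm.trans h') (by simp)
    | sand _ h' => exact absurd (h.symm.trans h') (by simp)
  · exact fun hx => Reach.bas (⟨x, h⟩ : T.Bas) hx

theorem reach_iff_of_or (h : T.typ x = NodeType.or) :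
    T.Reach O x ↔ ∃ y ∈ T.ch x, T.Reach O y := by
  constructor
  · intro hx
    cases hx with
    | bas a ha => exact absurd (h.symm.trans a.2) (by simp)
    | or _ y _ hy hr => exact ⟨y, hy, hr⟩
    | and _ h' => exact absurd (h.symm.trans h') (by simp)
    | sand _ h' => exact absurd (h.symm.trans h') (by simp)
  · rintro ⟨y, hy, hr⟩
    exact Reach.or x y h hy hr

theorem reach_iff_of_and (h : T.typ x = NodeType.and) :
    T.Reach O x ↔ ∀ y ∈ T.ch x, T.Reach O y := by
  constructor
  · intro hx
    cases hx with
    | bas a ha => exact absurd (h.symm.trans a.2) (by simp)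
    | or _ y h' => exact absurd (h.symm.trans h') (by simp)
    | and _ _ hr => exact hr
    | sand _ h' => exact absurd (h.symm.trans h') (by simp)
  · exact Reach.and x h

theorem reach_iff_of_sand (h : T.typ x = NodeType.sand) :
    T.Reach O x ↔ (∀ y ∈ T.ch x, T.Reach O y) ∧
      ∀ (i : ℕ) (hi : i + 1 < (T.ch x).length), ∀ a ∈ O.carrier, ∀ b ∈ O.carrier,
        T.Desc (T.ch x)[i] a.1 → T.Desc (T.ch x)[i + 1] b.1 → O.prec a b := by
  constructor
  · intro hx
    cases hx with
    | bas a ha => exact absurd (h.symm.trans a.2) (by simp)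
    | or _ y h' => exact absurd (h.symm.trans h') (by simp)
    | and _ h' => exact absurd (h.symm.trans h') (by simp)
    | sand _ _ hr hp => exact ⟨hr, hp⟩
  · exact fun hr => Reach.sand x h hr.1 hr.2

theorem ch_ne_nil {x : N} (h : T.typ x ≠ NodeType.bas) : ∃ y, y ∈ T.ch x :=
  List.exists_mem_of_ne_nil _ fun h' => h ((T.bas_iff_leaf x).2 h')

/-- A gate has at least one child, so AND and SAND gates are never reached vacuously. This is the
source of all nonemptiness of attacks. -/
theorem Reach.exists_desc (h : T.Reach O x) : ∃ a ∈ O.carrier, T.Desc x a.1 := by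
  induction h with
  | bas a ha => exact ⟨a, ha, Relation.ReflTransGen.refl⟩
  | or x y _ hy _ ih =>
    obtain ⟨a, ha, h⟩ := ih
    exact ⟨a, ha, Relation.ReflTransGen.head hy h⟩
  | and x ht _ ih =>
    obtain ⟨y, hy⟩ := ch_ne_nil (T := T) (x := x) (by simp [ht])
    obtain ⟨a, ha, h⟩ := ih y hy
    exact ⟨a, ha, Relation.ReflTransGen.head hy h⟩
  | sand x ht _ _ ih =>
    obtain ⟨y, hy⟩ := ch_ne_nil (T := T) (x := x) (by simp [ht])
    obtain ⟨a, ha, h⟩ := ih y hy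
    exact ⟨a, ha, Relation.ReflTransGen.head hy h⟩

end Reach

/-! ### The basic attack steps of `T_v` and of `T^v` -/

/-- The inclusion of the basic attack steps of `T_v`. -/
def subBas (T : AttackTree N) (v : N) (s : (T.sub v).Bas) : T.Bas := ⟨s.1.1, s.2⟩

theorem subBas_injective (T : AttackTree N) (v : N) : Function.Injective (T.subBas v) :=
  fun _ _ h => Subtype.ext (Subtype.ext (congrArg (fun a : T.Bas => a.1) h))

theorem exists_subBas {T : AttackTree N} {v : N} {a : T.Bas} (h : T.Desc v a.1) :
    ∃ s, T.subBas v s = a :=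
  ⟨⟨⟨a.1, h⟩, a.2⟩, rfl⟩

theorem desc_subBas (T : AttackTree N) (v : N) (s : (T.sub v).Bas) :
    T.Desc v (T.subBas v s).1 :=
  s.1.2

theorem proj_of_desc {T : AttackTree N} {v x : N} (h : T.Desc v x) : T.proj v x = none := by
  simp [proj, h]

theorem proj_of_not_desc {T : AttackTree N} {v x : N} (h : ¬ T.Desc v x) :
    T.proj v x = some ⟨x, h⟩ := by
  simp [proj, h]

section Replace

variable [Finite N]

/-- The new basic attack step of `T^v`. -/
def newBas (T : AttackTree N) (v : N) : (T.replace v).Bas := ⟨none, rfl⟩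

/-- The projection of the basic attack steps of `T` to those of `T^v`. -/
noncomputable def projBas (T : AttackTree N) (v : N) (a : T.Bas) : (T.replace v).Bas :=
  ⟨T.proj v a.1, by
    by_cases h : T.Desc v a.1
    · rw [proj_of_desc h]; rfl
    · rw [proj_of_not_desc h]; exact a.2⟩

variable {T : AttackTree N} {v : N}

theorem projBas_eq_newBas_iff {a : T.Bas} : T.projBas v a = T.newBas v ↔ T.Desc v a.1 := by
  constructor
  · intro h
    by_contra hn
    have := congrArg Subtype.val h
    simp only [projBas, newBas, proj_of_not_desc hn] at this
    cases this
  · exact fun h => Subtype.ext (proj_of_desc h)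

@[simp]
theorem projBas_subBas (s : (T.sub v).Bas) : T.projBas v (T.subBas v s) = T.newBas v :=
  projBas_eq_newBas_iff.2 (T.desc_subBas v s)

theorem eq_of_projBas_eq {a b : T.Bas} (h : T.projBas v a = T.projBas v b)
    (ha : T.projBas v a ≠ T.newBas v) : a = b := by
  have hb : ¬ T.Desc v b.1 := fun hb => ha (h.trans (projBas_eq_newBas_iff.2 hb))
  have h' : T.proj v a.1 = T.proj v b.1 := congrArg Subtype.val h
  rw [proj_of_not_desc hb] at h'
  exact Subtype.ext (T.proj_eq_some v _ _ h')

theorem exists_projBas {c : (T.replace v).Bas} (h : c ≠ T.newBas v) :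
    ∃ a, T.projBas v a = c := by
  obtain ⟨z, hz⟩ := c
  cases z with
  | none => exact absurd rfl h
  | some y => exact ⟨⟨y.1, hz⟩, Subtype.ext (proj_of_not_desc y.2)⟩

/-- An edge entering `T_v` from outside ends at `v`, so a path of `T^v` arriving at the new step
lifts to a path arriving at `v`, from which all of `T_v` is reachable. A node `y` strictly below `v`
must be excluded, as its projection forgets which one it is. -/
theorem desc_proj_iff (hv : T.IsModule v) {y : N} (hy : ¬ T.Desc v y ∨ y = v) (x : N) :
    (T.replace v).Desc (T.proj v y) (T.proj v x) ↔ T.Desc y x := by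
  constructor
  · have key : ∀ z, (T.replace v).Desc (T.proj v y) z → ∀ x, T.proj v x = z → T.Desc y x := by
      intro z hz
      induction hz with
      | refl =>
        intro x hx
        rcases hy with hy | rfl
        · rw [proj_of_not_desc hy] at hx
          rw [T.proj_eq_some v _ _ hx]
          exact Relation.ReflTransGen.refl
        · rw [proj_of_desc (x := y) Relation.ReflTransGen.refl] at hx
          by_contra h
          rw [proj_of_not_desc h] at hx
          cases hx
      | @tail b c _ hbc ih =>
        intro x hx
        cases b with
        | none => cases hbc
        | some b =>
          obtain ⟨w, hw, hwc⟩ := List.mem_map.1 (show c ∈ (T.ch b.1).map (T.proj v) from hbc)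
          have hyb : T.Desc y b.1 := ih b.1 (proj_of_not_desc b.2)
          have hxw : T.proj v x = T.proj v w := hx.trans hwc.symm
          by_cases hwd : T.Desc v w
          · obtain rfl := hv.2 b.1 w b.2 hwd hw
            rw [proj_of_desc hwd] at hxw
            have hxd : T.Desc w x := by
              by_contra h
              rw [proj_of_not_desc h] at hxw
              cases hxw
            exact (hyb.child hw).trans hxd
          · rw [proj_of_not_desc hwd] at hxw
            rw [T.proj_eq_some v _ _ hxw]
            exact hyb.child hw
    exact fun h => key _ h x rfl
  · intro h
    induction h with
    | refl => exact Relation.ReflTransGen.refl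
    | @tail b c _ hbc ih =>
      by_cases hb : T.Desc v b
      · rwa [proj_of_desc (hb.child hbc), ← proj_of_desc hb]
      · refine ih.tail ?_
        rw [proj_of_not_desc hb]
        exact List.mem_map.2 ⟨c, hbc, rfl⟩

end Replace

theorem desc_sub_iff {T : AttackTree N} {v : N} (x y : {x : N // T.Desc v x}) :
    (T.sub v).Desc x y ↔ T.Desc x.1 y.1 := by
  constructor
  · intro h
    induction h with
    | refl => exact Relation.ReflTransGen.refl
    | tail _ h ih => exact ih.tail ((T.mem_subCh v _ _).1 h)
  · obtain ⟨y, hy⟩ := y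
    intro h
    simp only at h
    induction h with
    | refl => exact Relation.ReflTransGen.refl
    | @tail b c hb hbc ih =>
      exact (ih (x.2.trans hb)).tail ((T.mem_subCh v ⟨b, x.2.trans hb⟩ ⟨c, hy⟩).2 hbc)

/-! ### Restriction, contraction and substitution of attacks -/

namespace Attack

/-- The empty attack serves as the inner part when the new step is not used. -/
instance (T : AttackTree N) : OrderBot T.Attack where
  bot :=
    { carrier := ∅
      prec := fun _ _ => False
      mem_of_prec := fun _ _ h => h.elim
      irrefl := fun _ h => h
      trans := fun _ _ _ h _ => h }
  bot_le _ := ⟨Set.empty_subset _, fun _ _ h => h.elim⟩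

/-- The restriction of an attack to a set of basic attack steps. -/
def restrict {T : AttackTree N} (O : T.Attack) (S : Set T.Bas) : T.Attack where
  carrier := O.carrier ∩ S
  prec a b := O.prec a b ∧ a ∈ S ∧ b ∈ S
  mem_of_prec a b h := ⟨⟨(O.mem_of_prec a b h.1).1, h.2.1⟩, (O.mem_of_prec a b h.1).2, h.2.2⟩
  irrefl a h := O.irrefl a h.1
  trans a b c h h' := ⟨O.trans a b c h.1 h'.1, h.2.1, h'.2.2⟩

theorem restrict_le {T : AttackTree N} (O : T.Attack) (S : Set T.Bas) : O.restrict S ≤ O :=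
  ⟨Set.inter_subset_left, fun _ _ h => h.1⟩

/-- The part of an attack inside `T_v`, as an attack on `T_v`. -/
def inside {T : AttackTree N} (v : N) (O : T.Attack) : (T.sub v).Attack where
  carrier := T.subBas v ⁻¹' O.carrier
  prec s t := O.prec (T.subBas v s) (T.subBas v t)
  mem_of_prec _ _ h := O.mem_of_prec _ _ h
  irrefl _ h := O.irrefl _ h
  trans _ _ _ h h' := O.trans _ _ _ h h'

variable [Finite N] {T : AttackTree N} (v : N)

/-- The attack on `T^v` obtained by merging all attack steps below `v` to the new one. -/
def contract (O : T.Attack) : (T.replace v).Attack where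
  carrier := T.projBas v '' O.carrier
  -- Steps are ordered only if their whole fibres are, which is the form of the SAND condition.
  -- Membership keeps the fibres nonempty, as irreflexivity and transitivity require.
  prec c d := c ∈ T.projBas v '' O.carrier ∧ d ∈ T.projBas v '' O.carrier ∧
    ∀ a ∈ O.carrier, ∀ b ∈ O.carrier, T.projBas v a = c → T.projBas v b = d → O.prec a b
  mem_of_prec _ _ h := ⟨h.1, h.2.1⟩
  irrefl c h := by
    obtain ⟨a, ha, rfl⟩ := h.1
    exact O.irrefl a (h.2.2 a ha a ha rfl rfl)
  trans c d e h h' := by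
    refine ⟨h.1, h'.2.1, fun a ha b hb hac hbe => ?_⟩
    obtain ⟨m, hm, hmd⟩ := h.2.1
    exact O.trans _ _ _ (h.2.2 a ha m hm hac hmd) (h'.2.2 m hm b hb hmd hbe)

variable {v}

/-- The set of basic attack steps of `T` obtained from `C` by replacing the new step by `C'`. -/
def _root_.AttackTree.substSet (C : Set (T.replace v).Bas) (C' : Set (T.sub v).Bas) : Set T.Bas :=
  {a | T.projBas v a ∈ C ∧ ∀ s, T.subBas v s = a → s ∈ C'}

/-- The attack on `T` obtained from `P` by replacing the new attack step by `Q`. -/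
def subst (P : (T.replace v).Attack) (Q : (T.sub v).Attack) : T.Attack where
  carrier := substSet P.carrier Q.carrier
  prec a b := a ∈ substSet P.carrier Q.carrier ∧ b ∈ substSet P.carrier Q.carrier ∧
    (P.prec (T.projBas v a) (T.projBas v b) ∨
      ∃ s t, T.subBas v s = a ∧ T.subBas v t = b ∧ Q.prec s t)
  mem_of_prec _ _ h := ⟨h.1, h.2.1⟩
  irrefl a h := by
    rcases h.2.2 with h | ⟨s, t, hs, ht, h⟩
    · exact P.irrefl _ h
    · rw [T.subBas_injective v (hs.trans ht.symm)] at h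
      exact Q.irrefl _ h
  trans a b c h h' := by
    refine ⟨h.1, h'.2.1, ?_⟩
    -- In the mixed cases both ends of the relation from `Q` project to the new step, so the
    -- relation from `P` already gives the conclusion.
    rcases h.2.2 with h1 | ⟨s, t, rfl, rfl, h1⟩ <;> rcases h'.2.2 with h2 | ⟨s', t', hs', rfl, h2⟩
    · exact Or.inl (P.trans _ _ _ h1 h2)
    · subst hs'
      refine Or.inl ?_
      rw [projBas_subBas] at h1 ⊢
      exact h1
    · refine Or.inl ?_
      rw [projBas_subBas] at h2 ⊢
      exact h2
    · obtain rfl := T.subBas_injective v hs'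
      exact Or.inr ⟨s, t', rfl, rfl, Q.trans _ _ _ h1 h2⟩

theorem mem_substSet_subBas {C : Set (T.replace v).Bas} {C' : Set (T.sub v).Bas}
    {s : (T.sub v).Bas} : T.subBas v s ∈ substSet C C' ↔ T.newBas v ∈ C ∧ s ∈ C' := by
  refine Iff.trans (and_congr_left' (by rw [projBas_subBas])) (and_congr_right fun _ => ?_)
  exact
    ⟨fun h => h s rfl, fun h t ht => by rwa [T.subBas_injective v ht]⟩

theorem mem_substSet_of_ne {C : Set (T.replace v).Bas} {C' : Set (T.sub v).Bas} {a : T.Bas}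
    (ha : T.projBas v a ≠ T.newBas v) : a ∈ substSet C C' ↔ T.projBas v a ∈ C := by
  refine ⟨fun h => h.1, fun h => ⟨h, ?_⟩⟩
  rintro s rfl
  simp at ha

theorem substSet_image_preimage (S : Set T.Bas) :
    substSet (T.projBas v '' S) (T.subBas v ⁻¹' S) = S := by
  ext a
  by_cases ha : T.projBas v a = T.newBas v
  · obtain ⟨s, rfl⟩ := exists_subBas (projBas_eq_newBas_iff.1 ha)
    rw [mem_substSet_subBas]
    exact ⟨fun h => h.2, fun h => ⟨⟨_, h, ha⟩, h⟩⟩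
  · rw [mem_substSet_of_ne ha]
    constructor
    · rintro ⟨b, hb, hba⟩
      rwa [← eq_of_projBas_eq hba (by rwa [hba])]
    · exact fun h => ⟨a, h, rfl⟩

/-- With an empty `C'` nothing would project to the new step; hence the hypothesis. -/
theorem image_substSet {C : Set (T.replace v).Bas} {C' : Set (T.sub v).Bas}
    (h : T.newBas v ∈ C → C'.Nonempty) : T.projBas v '' substSet C C' = C := by
  ext c
  constructor
  · rintro ⟨a, ha, rfl⟩
    exact ha.1
  · intro hc
    by_cases hn : c = T.newBas v
    · subst hn
      obtain ⟨s, hs⟩ := h hc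
      exact ⟨_, mem_substSet_subBas.2 ⟨hc, hs⟩, projBas_subBas s⟩
    · obtain ⟨a, rfl⟩ := exists_projBas hn
      exact ⟨a, (mem_substSet_of_ne hn).2 hc, rfl⟩

theorem preimage_substSet {C : Set (T.replace v).Bas} {C' : Set (T.sub v).Bas}
    (h : T.newBas v ∉ C → C' = ∅) : T.subBas v ⁻¹' substSet C C' = C' := by
  ext s
  rw [Set.mem_preimage, mem_substSet_subBas]
  refine ⟨fun h => h.2, fun hs => ⟨?_, hs⟩⟩
  by_contra hn
  simp [h hn] at hs

theorem subst_mono {P P' : (T.replace v).Attack} {Q Q' : (T.sub v).Attack} (hP : P ≤ P')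
    (hQ : T.newBas v ∈ P.carrier → Q ≤ Q') : subst P Q ≤ subst P' Q' := by
  have hsub : substSet P.carrier Q.carrier ⊆ substSet P'.carrier Q'.carrier := by
    rintro a ⟨ha, h⟩
    refine ⟨hP.1 ha, fun s hs => (hQ ?_).1 (h s hs)⟩
    rwa [← hs, projBas_subBas] at ha
  refine ⟨hsub, ?_⟩
  rintro a b ⟨ha, hb, h⟩
  refine ⟨hsub ha, hsub hb, h.imp (hP.2 _ _) fun h => ?_⟩
  obtain ⟨s, t, rfl, rfl, hst⟩ := h
  exact ⟨s, t, rfl, rfl, (hQ (mem_substSet_subBas.1 ha).1).2 _ _ hst⟩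

/-- The carriers agree, but relations between an outer step and only some of the steps below `v` are
lost. For minimal attacks the inequality becomes an equality. -/
theorem subst_contract_inside_le (O : T.Attack) : subst (O.contract v) (O.inside v) ≤ O := by
  have h : substSet (T.projBas v '' O.carrier) (T.subBas v ⁻¹' O.carrier) = O.carrier :=
    substSet_image_preimage _
  refine ⟨h.subset, ?_⟩
  rintro a b ⟨ha, hb, hab | ⟨s, t, rfl, rfl, hst⟩⟩
  · exact hab.2.2 a (h.subset ha) b (h.subset hb) rfl rfl
  · exact hst

theorem contract_le_of_le_subst {O : T.Attack} {P : (T.replace v).Attack} {Q : (T.sub v).Attack}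
    (h : O ≤ subst P Q) : O.contract v ≤ P := by
  constructor
  · rintro _ ⟨a, ha, rfl⟩
    exact (h.1 ha).1
  · rintro c d hcd
    obtain ⟨⟨a, ha, rfl⟩, ⟨b, hb, rfl⟩, hab⟩ := hcd
    rcases (h.2 _ _ (hab a ha b hb rfl rfl)).2.2 with h' | ⟨s, t, rfl, rfl, _⟩
    · exact h'
    -- Both steps project to the new one here, so `hab` would put a step before itself.
    · exact absurd (hab _ ha _ ha rfl (by simp)) (O.irrefl _)

theorem inside_le_of_le_subst {O : T.Attack} {P : (T.replace v).Attack} {Q : (T.sub v).Attack}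
    (h : O ≤ subst P Q) : O.inside v ≤ Q := by
  constructor
  · intro s hs
    exact (mem_substSet_subBas.1 (h.1 hs)).2
  · intro s t hst
    rcases (h.2 _ _ hst).2.2 with h' | ⟨s', t', hs, ht, h'⟩
    · rw [projBas_subBas, projBas_subBas] at h'
      exact absurd h' (P.irrefl _)
    · rwa [T.subBas_injective v hs, T.subBas_injective v ht] at h'

theorem contract_subst {P : (T.replace v).Attack} {Q : (T.sub v).Attack}
    (h : T.newBas v ∈ P.carrier → Q.carrier.Nonempty) : (subst P Q).contract v = P := by
  refine le_antisymm (contract_le_of_le_subst le_rfl) ⟨(image_substSet h).superset, ?_⟩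
  intro c d hcd
  have hc := (P.mem_of_prec _ _ hcd).1
  have hd := (P.mem_of_prec _ _ hcd).2
  refine ⟨(image_substSet h).superset hc, (image_substSet h).superset hd, ?_⟩
  rintro a ha b hb rfl rfl
  exact ⟨ha, hb, Or.inl hcd⟩

theorem inside_subst {P : (T.replace v).Attack} {Q : (T.sub v).Attack}
    (h : T.newBas v ∉ P.carrier → Q = ⊥) : (subst P Q).inside v = Q := by
  have hs : T.subBas v ⁻¹' substSet P.carrier Q.carrier = Q.carrier :=
    preimage_substSet fun hn => by rw [h hn]; rfl
  refine le_antisymm (inside_le_of_le_subst le_rfl) ⟨hs.superset, ?_⟩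
  intro s t hst
  exact ⟨hs.superset (Q.mem_of_prec _ _ hst).1, hs.superset (Q.mem_of_prec _ _ hst).2,
    Or.inr ⟨s, t, rfl, rfl, hst⟩⟩

end Attack

/-! ### Reaching nodes with restricted and contracted attacks -/

/-- Reaching a node involves only its descendants and the order among the steps below it, and for a
node of `T_v` all of these lie in `T_v`. -/
theorem reach_inside_iff [Finite N] {T : AttackTree N} {v : N} (O : T.Attack)
    (x : {x : N // T.Desc v x}) :
    (T.sub v).Reach (O.inside v) x ↔ T.Reach O x.1 := by
  obtain ⟨x, hx⟩ := x
  induction x using T.wellFounded_child.induction with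
  | _ x ih =>
    have ih' : ∀ y : {x : N // T.Desc v x}, y ∈ (T.sub v).ch ⟨x, hx⟩ →
        ((T.sub v).Reach (O.inside v) y ↔ T.Reach O y.1) := fun y hy =>
      ih y.1 ((T.mem_subCh v _ _).1 hy) y.2
    have hall : (∀ y ∈ (T.sub v).ch ⟨x, hx⟩, (T.sub v).Reach (O.inside v) y) ↔
        ∀ y ∈ T.ch x, T.Reach O y :=
      ⟨fun h y hy => (ih' ⟨y, hx.child hy⟩ ((T.mem_subCh v _ _).2 hy)).1
          (h _ ((T.mem_subCh v _ _).2 hy)),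
        fun h y hy => (ih' y hy).2 (h _ ((T.mem_subCh v _ _).1 hy))⟩
    have htyp : (T.sub v).typ ⟨x, hx⟩ = T.typ x := rfl
    cases ht : T.typ x with
    | bas =>
      rw [reach_iff_of_bas ht, reach_iff_of_bas (htyp.trans ht)]
      rfl
    | or =>
      rw [reach_iff_of_or ht, reach_iff_of_or (htyp.trans ht)]
      constructor
      · rintro ⟨y, hy, hr⟩
        exact ⟨y.1, (T.mem_subCh v _ _).1 hy, (ih' y hy).1 hr⟩
      · rintro ⟨y, hy, hr⟩
        have hy' : (⟨y, hx.child hy⟩ : {x : N // T.Desc v x}) ∈ (T.sub v).ch ⟨x, hx⟩ :=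
          (T.mem_subCh v _ _).2 hy
        exact ⟨_, hy', (ih' _ hy').2 hr⟩
    | and =>
      rw [reach_iff_of_and ht, reach_iff_of_and (htyp.trans ht), hall]
    | sand =>
      rw [reach_iff_of_sand ht, reach_iff_of_sand (htyp.trans ht), hall]
      refine and_congr_right fun _ => ?_
      have hlen : ((T.sub v).ch ⟨x, hx⟩).length = (T.ch x).length := by
        simp [sub, ofReachable, subCh]
      have hget : ∀ (i : ℕ) (h : i < ((T.sub v).ch ⟨x, hx⟩).length),
          (((T.sub v).ch ⟨x, hx⟩)[i]).1 = (T.ch x)[i]'(hlen ▸ h) := by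
        intro i h
        simp [sub, ofReachable, subCh]
      constructor
      · intro h i hi a ha b hb hda hdb
        obtain ⟨s, rfl⟩ := exists_subBas
          ((hx.child (List.getElem_mem (Nat.lt_of_succ_lt hi))).trans hda)
        obtain ⟨t, rfl⟩ := exists_subBas ((hx.child (List.getElem_mem hi)).trans hdb)
        refine h i (hlen.symm ▸ hi) s ha t hb ?_ ?_
        · rw [desc_sub_iff, hget]; exact hda
        · rw [desc_sub_iff, hget]; exact hdb
      · intro h i hi s hs t ht hds hdt
        rw [desc_sub_iff, hget] at hds hdt
        exact h i (hlen ▸ hi) _ hs _ ht hds hdt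

/-- Attack steps below an unreached module may be dropped. -/
theorem Reach.restrict_outside {T : AttackTree N} {v : N} (hv : T.IsModule v) {O : T.Attack} (hO : ¬ T.Reach O v) {x : N}
    (h : T.Reach O x) (hx : ¬ T.Desc v x) :
    T.Reach (O.restrict {a | ¬ T.Desc v a.1}) x := by
  -- The only child in `T_v` of an outer node is `v`, which is not reached; so the induction never
  -- enters `T_v`.
  have hch : ∀ x y, ¬ T.Desc v x → y ∈ T.ch x → T.Reach O y → ¬ T.Desc v y := by
    intro x y hx hy hr hd
    exact hO (hv.2 x y hx hd hy ▸ hr)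
  induction h with
  | bas a ha => exact Reach.bas a ⟨ha, hx⟩
  | or x y ht hy hr ih => exact Reach.or x y ht hy (ih (hch x y hx hy hr))
  | and x ht hr ih => exact Reach.and x ht fun y hy => ih y hy (hch x y hx hy (hr y hy))
  | sand x ht hr hp ih =>
    refine Reach.sand x ht (fun y hy => ih y hy (hch x y hx hy (hr y hy))) ?_
    exact fun i hi a ha b hb hda hdb => ⟨hp i hi a ha.1 b hb.1 hda hdb, ha.2, hb.2⟩

theorem Reach.carrier_nonempty {T : AttackTree N} {O : T.Attack} {x : N} (h : T.Reach O x) : O.carrier.Nonempty := by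
  obtain ⟨a, ha, _⟩ := h.exists_desc
  exact ⟨a, ha⟩

theorem reach_of_mem_minAttacks {T : AttackTree N} {O : T.Attack} (h : O ∈ T.minAttacks) :
    T.Reach O T.root :=
  Minimal.prop (P := fun O' => T.Reach O' T.root) h

theorem le_of_mem_minAttacks {T : AttackTree N} {O O' : T.Attack} (h : O ∈ T.minAttacks)
    (h' : T.Reach O' T.root) (hle : O' ≤ O) : O ≤ O' :=
  Minimal.le_of_le (P := fun O' => T.Reach O' T.root) h h' hle

section Replace

variable [Finite N] {T : AttackTree N} {v : N}

/-- The contraction contains the new step as soon as `O` has a step below `v`; `hO` makes this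
equivalent to `O` reaching `v`. The other nodes follow by induction over children, each of which is
`v` or outside `T_v`. -/
theorem reach_contract_iff (hv : T.IsModule v) {O : T.Attack}
    (hO : (∃ a ∈ O.carrier, T.Desc v a.1) → T.Reach O v) {x : N} (hx : ¬ T.Desc v x ∨ x = v) :
    (T.replace v).Reach (O.contract v) (T.proj v x) ↔ T.Reach O x := by
  induction x using T.wellFounded_child.induction with
  | _ x ih =>
    rcases hx with hx | rfl
    · have hch : ∀ y ∈ T.ch x, ¬ T.Desc v y ∨ y = v := fun y hy => by
        by_cases hd : T.Desc v y
        · exact Or.inr (hv.2 x y hx hd hy)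
        · exact Or.inl hd
      rw [proj_of_not_desc hx]
      have hch' : (T.replace v).ch (some ⟨x, hx⟩) = (T.ch x).map (T.proj v) := rfl
      have htyp : (T.replace v).typ (some ⟨x, hx⟩) = T.typ x := rfl
      have hall : (∀ y ∈ (T.replace v).ch (some ⟨x, hx⟩),
          (T.replace v).Reach (O.contract v) y) ↔ ∀ y ∈ T.ch x, T.Reach O y := by
        rw [hch', List.forall_mem_map]
        exact forall₂_congr fun y hy => ih y hy (hch y hy)
      cases ht : T.typ x with
      | bas =>
        rw [reach_iff_of_bas ht, reach_iff_of_bas (htyp.trans ht)]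
        have hp : T.projBas v ⟨x, ht⟩ = (⟨some ⟨x, hx⟩, ht⟩ : (T.replace v).Bas) :=
          Subtype.ext (proj_of_not_desc hx)
        constructor
        · rintro ⟨a, ha, hax⟩
          have hne : T.projBas v a ≠ T.newBas v := fun h => by
            have := congrArg Subtype.val (hax.symm.trans h)
            cases this
          rwa [← eq_of_projBas_eq (hax.trans hp.symm) hne]
        · exact fun h => ⟨_, h, hp⟩
      | or =>
        rw [reach_iff_of_or ht, reach_iff_of_or (htyp.trans ht), hch']
        constructor
        · rintro ⟨_, hy', hr⟩
          obtain ⟨y, hy, rfl⟩ := List.mem_map.1 hy'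
          exact ⟨y, hy, (ih y hy (hch y hy)).1 hr⟩
        · rintro ⟨y, hy, hr⟩
          exact ⟨_, List.mem_map.2 ⟨y, hy, rfl⟩, (ih y hy (hch y hy)).2 hr⟩
      | and =>
        rw [reach_iff_of_and ht, reach_iff_of_and (htyp.trans ht), hall]
      | sand =>
        rw [reach_iff_of_sand ht, reach_iff_of_sand (htyp.trans ht), hall]
        refine and_congr_right fun _ => ?_
        have hlen : ((T.replace v).ch (some ⟨x, hx⟩)).length = (T.ch x).length := by
          rw [hch', List.length_map]
        have hget : ∀ (i : ℕ) (h : i < ((T.replace v).ch (some ⟨x, hx⟩)).length),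
            ((T.replace v).ch (some ⟨x, hx⟩))[i] = T.proj v ((T.ch x)[i]'(hlen ▸ h)) := by
          intro i h
          simp [hch']
        -- Lying below a child is constant on the fibres of `projBas`, so the SAND condition for all
        -- pairs of steps matches the order of the contraction.
        have hdesc : ∀ (i : ℕ) (h : i < (T.ch x).length) (a : T.Bas),
            (T.replace v).Desc (T.proj v (T.ch x)[i]) (T.projBas v a).1 ↔
              T.Desc (T.ch x)[i] a.1 := fun i h a =>
          desc_proj_iff hv (hch _ (List.getElem_mem h)) a.1
        constructor
        · intro h i hi a ha b hb hda hdb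
          refine (h i (hlen.symm ▸ hi) _ ⟨a, ha, rfl⟩ _ ⟨b, hb, rfl⟩ ?_ ?_).2.2 a ha b hb rfl rfl
          · rw [hget]; exact (hdesc _ _ _).2 hda
          · rw [hget]; exact (hdesc _ _ _).2 hdb
        · intro h i hi c hc d hd hdc hdd
          refine ⟨hc, hd, ?_⟩
          rintro a ha b hb rfl rfl
          rw [hget] at hdc hdd
          exact h i (hlen ▸ hi) a ha b hb ((hdesc _ _ _).1 hdc) ((hdesc _ _ _).1 hdd)
    · have hp : T.proj x x = none := proj_of_desc Relation.ReflTransGen.refl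
      have htyp : (T.replace x).typ (none) = NodeType.bas := rfl
      rw [hp, reach_iff_of_bas htyp]
      constructor
      · rintro ⟨a, ha, h⟩
        exact hO ⟨a, ha, projBas_eq_newBas_iff.1 h⟩
      · intro h
        obtain ⟨a, ha, hd⟩ := h.exists_desc
        exact ⟨a, ha, projBas_eq_newBas_iff.2 hd⟩

theorem reach_root_contract_iff (hv : T.IsModule v) {O : T.Attack}
    (hO : (∃ a ∈ O.carrier, T.Desc v a.1) → T.Reach O v) :
    (T.replace v).Reach (O.contract v) (T.replace v).root ↔ T.Reach O T.root := by
  refine reach_contract_iff hv hO ?_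
  by_cases h : T.Desc v T.root
  · right
    rcases Relation.ReflTransGen.cases_tail h with h | ⟨p, _, hp⟩
    · exact h
    · exact absurd hp (T.root_no_parent p)
  · exact Or.inl h

omit [Finite N] in
-- Provides the side condition of `reach_contract_iff` after passing to a smaller attack; a minimal
-- attack therefore satisfies it itself.
theorem exists_le_reach (hv : T.IsModule v) {O : T.Attack} (h : T.Reach O T.root) :
    ∃ O' ≤ O, T.Reach O' T.root ∧ ((∃ a ∈ O'.carrier, T.Desc v a.1) → T.Reach O' v) := by
  by_cases hO : T.Reach O v
  · exact ⟨O, le_rfl, h, fun _ => hO⟩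
  · refine ⟨_, O.restrict_le {a | ¬ T.Desc v a.1}, h.restrict_outside hv hO ?_, ?_⟩
    · intro hd
      rcases Relation.ReflTransGen.cases_tail hd with h' | ⟨p, _, hp⟩
      · exact hO (h' ▸ h)
      · exact T.root_no_parent p hp
    · rintro ⟨a, ha, hd⟩
      exact absurd hd ha.2

/-! ### The minimal attacks of `T` -/

theorem newBas_mem_contract_iff {O : T.Attack} :
    T.newBas v ∈ (O.contract v).carrier ↔ ∃ a ∈ O.carrier, T.Desc v a.1 := by
  constructor
  · rintro ⟨a, ha, h⟩
    exact ⟨a, ha, projBas_eq_newBas_iff.1 h⟩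
  · rintro ⟨a, ha, h⟩
    exact ⟨a, ha, projBas_eq_newBas_iff.2 h⟩

/-- Contraction and inner part of `P.subst Q` are `P` and `Q`, so the criterion for contractions
applies. -/
theorem reach_subst_root_iff (hv : T.IsModule v) {P : (T.replace v).Attack}
    {Q : (T.sub v).Attack}
    (h₁ : T.newBas v ∈ P.carrier → (T.sub v).Reach Q (T.sub v).root)
    (h₂ : T.newBas v ∉ P.carrier → Q = ⊥) :
    T.Reach (P.subst Q) T.root ↔ (T.replace v).Reach P (T.replace v).root := by
  have hc := Attack.contract_subst fun h => (h₁ h).carrier_nonempty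
  rw [← reach_root_contract_iff hv, hc]
  intro h
  rw [← newBas_mem_contract_iff, hc] at h
  have := h₁ h
  rw [← Attack.inside_subst h₂] at this
  exact (reach_inside_iff _ _).1 this

/-- The minimal attacks of `T` arise from those of `T^v` by substitution. -/
theorem mem_minAttacks_iff (hv : T.IsModule v) (O : T.Attack) :
    O ∈ T.minAttacks ↔ ∃ P ∈ (T.replace v).minAttacks, ∃ Q : (T.sub v).Attack,
      (T.newBas v ∈ P.carrier → Q ∈ (T.sub v).minAttacks) ∧ (T.newBas v ∉ P.carrier → Q = ⊥) ∧
      O = P.subst Q := by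
  constructor
  · intro hO
    obtain ⟨O', hle, hr, hadm⟩ := exists_le_reach hv (reach_of_mem_minAttacks hO)
    obtain rfl : O = O' := le_antisymm (le_of_mem_minAttacks hO hr hle) hle
    have hP : (T.replace v).Reach (O.contract v) (T.replace v).root :=
      (reach_root_contract_iff hv hadm).2 hr
    -- The inner part is not yet known to be minimal. Substituting a minimal `Q` below it gives a
    -- successful attack below `O`, which must then be `O`.
    have hQ : ∃ Q ≤ O.inside v,
        (T.newBas v ∈ (O.contract v).carrier → Q ∈ (T.sub v).minAttacks) ∧
        (T.newBas v ∉ (O.contract v).carrier → Q = ⊥) := by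
      by_cases h : T.newBas v ∈ (O.contract v).carrier
      · have hv' := (reach_inside_iff O (T.sub v).root).2 (hadm (newBas_mem_contract_iff.1 h))
        obtain ⟨Q, hle, hQ⟩ := exists_minimal_le_of_wellFoundedLT
          (fun Q => (T.sub v).Reach Q (T.sub v).root) _ hv'
        exact ⟨Q, hle, fun _ => hQ, fun h' => absurd h h'⟩
      · exact ⟨⊥, bot_le, fun h' => absurd h' h, fun _ => rfl⟩
    obtain ⟨Q, hQle, hQ₁, hQ₂⟩ := hQ
    have hsub : (O.contract v).subst Q ≤ O :=
      (Attack.subst_mono le_rfl fun _ => hQle).trans (Attack.subst_contract_inside_le O)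
    have hOeq : O = (O.contract v).subst Q := le_antisymm
      (le_of_mem_minAttacks hO ((reach_subst_root_iff hv (fun h => reach_of_mem_minAttacks (hQ₁ h)) hQ₂).2 hP) hsub) hsub
    refine ⟨O.contract v, ⟨hP, fun P hPr hPle => ?_⟩, Q, hQ₁, hQ₂, hOeq⟩
    -- A successful `P` below the contraction yields a successful substitution below `O`, hence
    -- equal to it; contracting gives minimality.
    by_cases h : T.newBas v ∈ P.carrier
    · have hr' := (reach_subst_root_iff hv (P := P) (Q := Q)
        (fun _ => reach_of_mem_minAttacks (hQ₁ (hPle.1 h))) (fun h' => absurd h h')).2 hPr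
      exact Attack.contract_le_of_le_subst (le_of_mem_minAttacks hO hr'
        ((Attack.subst_mono hPle fun _ => le_rfl).trans hsub))
    · have hr' := (reach_subst_root_iff hv (P := P) (Q := ⊥)
        (fun h' => absurd h' h) (fun _ => rfl)).2 hPr
      exact Attack.contract_le_of_le_subst (le_of_mem_minAttacks hO hr'
        ((Attack.subst_mono hPle fun _ => bot_le).trans hsub))
  · rintro ⟨P, hP, Q, hQ₁, hQ₂, rfl⟩
    refine ⟨(reach_subst_root_iff hv (fun h => reach_of_mem_minAttacks (hQ₁ h)) hQ₂).2 (reach_of_mem_minAttacks hP), fun O hO hle => ?_⟩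
    -- A competitor `O'` is compared with `P` by contraction and with `Q` by its inner part; the two
    -- resulting inequalities are then substituted back.
    obtain ⟨O', hle', hr, hadm⟩ := exists_le_reach hv hO
    have hPle : P ≤ O'.contract v := le_of_mem_minAttacks hP ((reach_root_contract_iff hv hadm).2 hr)
      (Attack.contract_le_of_le_subst (hle'.trans hle))
    refine le_trans (Attack.subst_mono hPle fun h => ?_)
      ((Attack.subst_contract_inside_le O').trans hle')
    exact le_of_mem_minAttacks (hQ₁ h) ((reach_inside_iff O' (T.sub v).root).2
      (hadm (newBas_mem_contract_iff.1 (hPle.1 h))))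
      (Attack.inside_le_of_le_subst (hle'.trans hle))

end Replace

/-! ### Maximal chains -/

namespace Attack

section Chains

variable {T : AttackTree N}

/-- Comparability of two attack steps in an attack. -/
def Comparable (O : T.Attack) (a b : T.Bas) : Prop := O.prec a b ∨ O.prec b a

theorem Comparable.symm {O : T.Attack} {a b : T.Bas} (h : O.Comparable a b) :
    O.Comparable b a :=
  Or.symm h

/-- A set of pairwise comparable attack steps of `O`. -/
def IsChainIn (O : T.Attack) (C : Set T.Bas) : Prop :=
  C ⊆ O.carrier ∧ ∀ a ∈ C, ∀ b ∈ C, a ≠ b → O.Comparable a b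

/-- Walk up the list while `x` lies above the current entry. The next entry is `x`, lies below `x`,
or would have `x` strictly between it and its predecessor, which is excluded for direct successors.
The walk stops at the latest at the last entry, above which there is nothing. -/
theorem mem_of_isChain_directSucc {O : T.Attack} {x : T.Bas} :
    ∀ (l : List T.Bas) (hl : l ≠ []), l.IsChain O.DirectSucc →
      (∀ b, ¬ O.prec (l.getLast hl) b) → (∀ a ∈ l, a ≠ x → O.Comparable a x) →
      (x = l.head hl ∨ O.prec (l.head hl) x) → x ∈ l
  | [], hl, _, _, _, _ => absurd rfl hl
  | [a], _, _, hlast, _, hx => by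
    rcases hx with hx | hx
    · simpa using hx
    · exact absurd hx (hlast x)
  | a :: b :: l, _, hch, hlast, hcomp, hx => by
    rcases hx with hx | hx
    · simp [show x = a from hx]
    · rw [List.isChain_cons_cons] at hch
      refine List.mem_cons_of_mem _ (mem_of_isChain_directSucc (b :: l) (by simp) hch.2
        (by simpa using hlast) (fun c hc => hcomp c (List.mem_cons_of_mem _ hc)) ?_)
      by_cases hbx : b = x
      · exact Or.inl hbx.symm
      · rcases hcomp b (by simp) hbx with h | h
        · exact Or.inr h
        · exact absurd ⟨hx, h⟩ (hch.1.2 x)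

/-- Split off a minimal element, which in a chain precedes all others. -/
theorem exists_sorted_list [Finite N] {O : T.Attack} (C : Set T.Bas) (hC : O.IsChainIn C) :
    ∃ l : List T.Bas, C = {a | a ∈ l} ∧ l.Pairwise O.prec := by
  have : IsTrans T.Bas O.prec := ⟨O.trans⟩
  have : Std.Irrefl O.prec := ⟨O.irrefl⟩
  have wf : WellFounded O.prec := Finite.wellFounded_of_trans_of_irrefl O.prec
  induction C using WellFoundedLT.induction with
  | _ C ih =>
    rcases C.eq_empty_or_nonempty with rfl | hne
    · exact ⟨[], by ext; simp, List.Pairwise.nil⟩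
    · obtain ⟨m, hm, hmin⟩ := wf.has_min C hne
      obtain ⟨l, hl, hs⟩ := ih (C \ {m})
        ⟨Set.sdiff_subset, fun h => (h hm).2 rfl⟩
        ⟨Set.sdiff_subset.trans hC.1, fun a ha b hb => hC.2 a ha.1 b hb.1⟩
      have hmem : ∀ a, a ∈ l ↔ a ∈ C ∧ a ≠ m := fun a =>
        (Set.ext_iff.1 hl a).symm
      refine ⟨m :: l, ?_, List.pairwise_cons.2 ⟨fun a ha => ?_, hs⟩⟩
      · ext a
        show a ∈ C ↔ a ∈ m :: l
        rw [List.mem_cons, hmem]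
        by_cases h : a = m
        · simp [h, hm]
        · simp [h]
      · obtain ⟨haC, ham⟩ := (hmem a).1 ha
        rcases hC.2 a haC m hm ham with h | h
        · exact absurd h (hmin a haC)
        · exact h

/-- The maximal chains are the inclusion-maximal nonempty chains. -/
theorem mem_maxChains_iff [Finite N] {O : T.Attack} {C : Set T.Bas} :
    C ∈ O.maxChains ↔ C.Nonempty ∧ O.IsChainIn C ∧
      ∀ x ∈ O.carrier, (∀ a ∈ C, a ≠ x → O.Comparable a x) → x ∈ C := by
  have : IsTrans T.Bas O.prec := ⟨O.trans⟩
  constructor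
  · rintro ⟨l, hl, rfl, hsub, hhead, hlast, hch⟩
    have hpw : l.Pairwise O.prec := List.isChain_iff_pairwise.1 (hch.imp fun _ _ h => h.1)
    refine ⟨⟨_, List.head_mem hl⟩, ⟨hsub, fun a ha b hb hab => ?_⟩, fun x hx hcomp => ?_⟩
    · obtain ⟨i, hi, rfl⟩ := List.getElem_of_mem ha
      obtain ⟨j, hj, rfl⟩ := List.getElem_of_mem hb
      rw [List.pairwise_iff_getElem] at hpw
      rcases lt_trichotomy i j with h | rfl | h
      · exact Or.inl (hpw i j hi hj h)
      · exact absurd rfl hab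
      · exact Or.inr (hpw j i hj hi h)
    · refine mem_of_isChain_directSucc l hl hch hlast hcomp ?_
      by_cases h : l.head hl = x
      · exact Or.inl h.symm
      · exact Or.inr ((hcomp _ (List.head_mem hl) h).resolve_right (hhead x))
  · rintro ⟨hne, hC, hmax⟩
    obtain ⟨l, rfl, hpw⟩ := exists_sorted_list C hC
    have hl : l ≠ [] := by
      rintro rfl
      obtain ⟨a, ha⟩ := hne
      exact absurd ha List.not_mem_nil
    rw [List.pairwise_iff_getElem] at hpw
    -- A step comparable with every entry would be an entry itself, hence comparable with itself. A
    -- violation of any of the three remaining conditions produces such a step.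
    have hmax' : ∀ x ∈ O.carrier, (∀ (j : ℕ) (hj : j < l.length), O.Comparable l[j] x) →
        False := by
      intro x hx h
      obtain ⟨j, hj, rfl⟩ := List.getElem_of_mem (hmax x hx fun a ha _ => by
        obtain ⟨j, hj, rfl⟩ := List.getElem_of_mem ha
        exact h j hj)
      rcases h j hj with h | h <;> exact O.irrefl _ h
    refine ⟨l, hl, rfl, hC.1, fun b hb => ?_, fun b hb => ?_, ?_⟩
    · rw [List.head_eq_getElem] at hb
      refine hmax' b (O.mem_of_prec _ _ hb).1 fun j hj => Or.inr ?_
      rcases j.eq_zero_or_pos with rfl | h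
      · exact hb
      · exact O.trans _ _ _ hb (hpw _ _ _ hj h)
    · rw [List.getLast_eq_getElem] at hb
      refine hmax' b (O.mem_of_prec _ _ hb).2 fun j hj => Or.inl ?_
      rcases (Nat.le_sub_one_of_lt hj).eq_or_lt with rfl | h
      · exact hb
      · exact O.trans _ _ _ (hpw _ _ hj _ h) hb
    · rw [List.isChain_iff_getElem]
      intro i hi
      refine ⟨hpw _ _ _ _ (Nat.lt_succ_self i), fun c hc => ?_⟩
      refine hmax' c (O.mem_of_prec _ _ hc.1).2 fun j hj => ?_
      rcases lt_trichotomy j i with h | rfl | h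
      · exact Or.inl (O.trans _ _ _ (hpw _ _ hj _ h) hc.1)
      · exact Or.inl hc.1
      · rcases (Nat.succ_le_of_lt h).eq_or_lt with rfl | h
        · exact Or.inr hc.2
        · exact Or.inr (O.trans _ _ _ hc.2 (hpw _ _ _ hj h))

theorem exists_mem_maxChains [Finite N] {O : T.Attack} {a : T.Bas} (ha : a ∈ O.carrier) :
    ∃ C ∈ O.maxChains, a ∈ C := by
  have h₁ : O.IsChainIn {a} := by
    refine ⟨Set.singleton_subset_iff.2 ha, ?_⟩
    rintro b rfl c rfl hbc
    exact absurd rfl hbc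
  obtain ⟨C, hle, hC⟩ := (Set.toFinite {C | O.IsChainIn C}).exists_le_maximal h₁
  refine ⟨C, mem_maxChains_iff.2 ⟨⟨a, hle rfl⟩, hC.prop, fun x hx hcomp => ?_⟩, hle rfl⟩
  refine hC.le_of_ge (y := insert x C) ⟨Set.insert_subset hx hC.prop.1, ?_⟩
    (Set.subset_insert x C) (Set.mem_insert x C)
  rintro b (rfl | hb) c (rfl | hc) hbc
  · exact absurd rfl hbc
  · exact (hcomp c hc hbc.symm).symm
  · exact hcomp b hb hbc
  · exact hC.prop.2 b hb c hc hbc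

theorem maxChains_nonempty [Finite N] {O : T.Attack} (h : O.carrier.Nonempty) :
    O.maxChains.Nonempty := by
  obtain ⟨a, ha⟩ := h
  obtain ⟨C, hC, _⟩ := exists_mem_maxChains ha
  exact ⟨C, hC⟩

end Chains

/-! ### Maximal chains of a substituted attack. -/

section Subst

variable [Finite N] {T : AttackTree N} {v : N} {P : (T.replace v).Attack} {Q : (T.sub v).Attack}

theorem comparable_subst_iff {a b : T.Bas} :
    (P.subst Q).Comparable a b ↔ a ∈ (P.subst Q).carrier ∧ b ∈ (P.subst Q).carrier ∧
      (P.Comparable (T.projBas v a) (T.projBas v b) ∨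
        ∃ s t, T.subBas v s = a ∧ T.subBas v t = b ∧ Q.Comparable s t) := by
  constructor
  · rintro (⟨ha, hb, h⟩ | ⟨hb, ha, h⟩)
    · exact ⟨ha, hb, h.imp Or.inl fun ⟨s, t, hs, ht, h⟩ => ⟨s, t, hs, ht, Or.inl h⟩⟩
    · exact ⟨ha, hb, h.imp Or.inr fun ⟨s, t, hs, ht, h⟩ => ⟨t, s, ht, hs, Or.inr h⟩⟩
  · rintro ⟨ha, hb, (h | h) | ⟨s, t, hs, ht, h | h⟩⟩
    · exact Or.inl ⟨ha, hb, Or.inl h⟩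
    · exact Or.inr ⟨hb, ha, Or.inl h⟩
    · exact Or.inl ⟨ha, hb, Or.inr ⟨s, t, hs, ht, h⟩⟩
    · exact Or.inr ⟨hb, ha, Or.inr ⟨t, s, ht, hs, h⟩⟩

/-- The maximal chains of a substitution arise from those of `P` by substitution. -/
theorem mem_maxChains_subst_iff (hPQ : T.newBas v ∈ P.carrier → Q.carrier.Nonempty)
    (S : Set T.Bas) :
    S ∈ (P.subst Q).maxChains ↔ ∃ C ∈ P.maxChains, ∃ C' : Set (T.sub v).Bas,
      (T.newBas v ∈ C → C' ∈ Q.maxChains) ∧ (T.newBas v ∉ C → C' = ∅) ∧ S = substSet C C' := by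
  constructor
  · intro hS
    obtain ⟨hne, hch, hmax⟩ := mem_maxChains_iff.1 hS
    refine ⟨T.projBas v '' S, mem_maxChains_iff.2 ⟨hne.image _, ⟨?_, ?_⟩, ?_⟩,
      T.subBas v ⁻¹' S, fun hn => mem_maxChains_iff.2 ⟨?_, ⟨?_, ?_⟩, ?_⟩, ?_,
      (substSet_image_preimage S).symm⟩
    · rintro _ ⟨a, ha, rfl⟩
      exact (hch.1 ha).1
    · rintro _ ⟨a, ha, rfl⟩ _ ⟨b, hb, rfl⟩ hab
      rcases (comparable_subst_iff.1 (hch.2 a ha b hb fun h => hab (h ▸ rfl))).2.2 with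
        h | ⟨s, t, rfl, rfl, _⟩
      · exact h
      · simp at hab
    · intro c hc hcomp
      by_contra hcS
      -- Lift `c` to a step of the substitution; it is comparable with all of `S`, so it belongs to
      -- `S`.
      rw [← image_substSet hPQ] at hc
      obtain ⟨a, ha, rfl⟩ := hc
      refine hcS ⟨a, hmax a ha fun b hb _ => comparable_subst_iff.2 ⟨hch.1 hb, ha, Or.inl ?_⟩, rfl⟩
      exact hcomp _ ⟨b, hb, rfl⟩ fun h => hcS ⟨b, hb, h⟩
    · obtain ⟨a, ha, hn⟩ := hn
      obtain ⟨s, rfl⟩ := exists_subBas (projBas_eq_newBas_iff.1 hn)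
      exact ⟨s, ha⟩
    · intro s hs
      exact (mem_substSet_subBas.1 (hch.1 hs)).2
    · intro s hs t ht hst
      rcases (comparable_subst_iff.1 (hch.2 _ hs _ ht
        fun h => hst (T.subBas_injective v h))).2.2 with h | ⟨s', t', hs', ht', h⟩
      · rw [projBas_subBas, projBas_subBas] at h
        rcases h with h | h <;> exact absurd h (P.irrefl _)
      · rwa [T.subBas_injective v hs', T.subBas_injective v ht'] at h
    · intro s hs hcomp
      have hnP : T.newBas v ∈ P.carrier := by
        obtain ⟨a, ha, hn⟩ := hn
        exact hn ▸ (hch.1 ha).1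
      have hsc : T.subBas v s ∈ (P.subst Q).carrier := mem_substSet_subBas.2 ⟨hnP, hs⟩
      refine hmax _ hsc fun b hb hbs => comparable_subst_iff.2 ⟨hch.1 hb, hsc, ?_⟩
      by_cases hbn : T.projBas v b = T.newBas v
      · obtain ⟨t, rfl⟩ := exists_subBas (projBas_eq_newBas_iff.1 hbn)
        exact Or.inr ⟨t, s, rfl, rfl, hcomp t hb fun h => hbs (h ▸ rfl)⟩
      -- An outer `b` is comparable with one step below `v` iff with all of them, and `S` contains
      -- such a step `a`.
      · obtain ⟨a, ha, hn⟩ := hn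
        rw [projBas_subBas, ← hn]
        rcases (comparable_subst_iff.1 (hch.2 b hb a ha
          fun h => hbn (h ▸ hn))).2.2 with h | ⟨s', t', rfl, rfl, _⟩
        · exact Or.inl h
        · simp at hbn
    · intro hn
      ext s
      simp only [Set.mem_preimage, Set.mem_empty_iff_false, iff_false]
      exact fun hs => hn ⟨_, hs, projBas_subBas s⟩
  · rintro ⟨C, hC, C', hC₁, hC₂, rfl⟩
    obtain ⟨hne, hch, hmax⟩ := mem_maxChains_iff.1 hC
    have hne' : T.newBas v ∈ C → C'.Nonempty := fun h => (mem_maxChains_iff.1 (hC₁ h)).1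
    have hsub : substSet C C' ⊆ (P.subst Q).carrier := by
      rintro a ⟨ha, h⟩
      refine ⟨hch.1 ha, ?_⟩
      rintro s rfl
      rw [projBas_subBas] at ha
      exact (mem_maxChains_iff.1 (hC₁ ha)).2.1.1 (h s rfl)
    refine mem_maxChains_iff.2 ⟨?_, ⟨hsub, ?_⟩, ?_⟩
    · rw [← Set.image_nonempty (f := T.projBas v), image_substSet hne']
      exact hne
    · intro a ha b hb hab
      refine comparable_subst_iff.2 ⟨hsub ha, hsub hb, ?_⟩
      by_cases hp : T.projBas v a = T.projBas v b
      · have han : T.projBas v a = T.newBas v := by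
          by_contra h
          exact hab (eq_of_projBas_eq hp h)
        obtain ⟨s, rfl⟩ := exists_subBas (projBas_eq_newBas_iff.1 han)
        obtain ⟨t, rfl⟩ := exists_subBas (projBas_eq_newBas_iff.1 (hp.symm.trans han))
        rw [mem_substSet_subBas] at ha hb
        exact Or.inr ⟨s, t, rfl, rfl, (mem_maxChains_iff.1 (hC₁ ha.1)).2.1.2 s ha.2 t hb.2
          fun h => hab (h ▸ rfl)⟩
      · exact Or.inl (hch.2 _ ha.1 _ hb.1 hp)
    · intro x hx hcomp
      have hxC : T.projBas v x ∈ C := by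
        by_contra hxC
        refine hxC (hmax _ hx.1 ?_)
        rw [← image_substSet hne']
        rintro _ ⟨a, ha, rfl⟩ hax
        rcases (comparable_subst_iff.1 (hcomp a ha fun h => hax (h ▸ rfl))).2.2 with
          h | ⟨s, t, rfl, rfl, _⟩
        · exact h
        · simp at hax
      refine ⟨hxC, ?_⟩
      rintro s rfl
      rw [projBas_subBas] at hxC
      refine (mem_maxChains_iff.1 (hC₁ hxC)).2.2 s (mem_substSet_subBas.1 hx).2 fun t ht hts => ?_
      rcases (comparable_subst_iff.1 (hcomp (T.subBas v t) (mem_substSet_subBas.2 ⟨hxC, ht⟩)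
        fun h => hts (T.subBas_injective v h))).2.2 with h | ⟨s', t', hs', ht', h⟩
      · rw [projBas_subBas, projBas_subBas] at h
        rcases h with h | h <;> exact absurd h (P.irrefl _)
      · rwa [T.subBas_injective v hs', T.subBas_injective v ht'] at h

end Subst

end Attack

end AttackTree

/-- Combination over a family that is parametrised by dependent pairs. -/
theorem bigOp_dependent_pairs {V : Type w} {ι κ μ : Type*} [Finite ι] [Finite κ] [Finite μ]
    (op : V → V → V) [Std.Commutative op] [Std.Associative op] {S : Set ι} {S₁ : Set κ}
    {K : κ → Set μ} {g : κ → μ → ι} {r : ι → κ} {r' : ι → μ}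
    (hS : ∀ i, i ∈ S ↔ ∃ p ∈ S₁, ∃ q ∈ K p, i = g p q)
    (hr : ∀ p ∈ S₁, ∀ q ∈ K p, r (g p q) = p) (hr' : ∀ p ∈ S₁, ∀ q ∈ K p, r' (g p q) = q)
    (f : ι → Option V) :
    bigOp op S f = bigOp op S₁ fun p => bigOp op (K p) fun q => f (g p q) := by
  have hmaps : Set.MapsTo r S S₁ := by
    intro i hi
    obtain ⟨p, hp, q, hq, rfl⟩ := (hS i).1 hi
    rwa [hr p hp q hq]
  rw [bigOp_fiberwise op hmaps]
  refine bigOp_congr op fun p hp => ?_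
  have hfib : {i | i ∈ S ∧ r i = p} = g p '' K p := by
    ext i
    constructor
    · rintro ⟨hi, h⟩
      obtain ⟨p', hp', q, hq, rfl⟩ := (hS i).1 hi
      rw [hr p' hp' q hq] at h
      subst h
      exact ⟨q, hq, rfl⟩
    · rintro ⟨q, hq, rfl⟩
      exact ⟨(hS _).2 ⟨p, hp, q, hq, rfl⟩, hr p hp q hq⟩
  rw [hfib, bigOp_image]
  intro q hq q' hq' h
  rw [← hr' p hp q hq, ← hr' p hp q' hq']
  exact congrArg r' h

namespace AttackTree

variable {N : Type u} [Finite N] {V : Type w} {T : AttackTree N} {v : N}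

/-! ### Values of substituted sets -/

section Value

open Attack

theorem replaceAttr_projBas (α : T.Bas → V) (x : V) {a : T.Bas}
    (ha : T.projBas v a ≠ T.newBas v) : T.replaceAttr v α x (T.projBas v a) = α a := by
  have hd : ¬ T.Desc v a.1 := fun h => ha (projBas_eq_newBas_iff.2 h)
  have h : T.projBas v a = ⟨some ⟨a.1, hd⟩, a.2⟩ := Subtype.ext (proj_of_not_desc hd)
  rw [h]
  rfl

variable (op : V → V → V) [Std.Commutative op] [Std.Associative op] (α : T.Bas → V)

/-- `substSet C ∅` is the copy in `T` of the steps of `C` other than the new one; written this way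
the value visibly does not depend on `x`. -/
theorem bigOp_of_newBas_notMem {C : Set (T.replace v).Bas} (hC : T.newBas v ∉ C) (x : V) :
    bigOp op C (fun c => some (T.replaceAttr v α x c)) =
      bigOp op (substSet C ∅) fun a => some (α a) := by
  have hne : ∀ a ∈ substSet C (∅ : Set (T.sub v).Bas), T.projBas v a ≠ T.newBas v :=
    fun a ha h => hC (h ▸ ha.1)
  conv_lhs => rw [← image_substSet (C := C) (C' := ∅) fun h => absurd h hC]
  rw [bigOp_image op fun a ha b _ h => eq_of_projBas_eq h (hne a ha)]
  exact bigOp_congr op fun a ha => by rw [replaceAttr_projBas α x (hne a ha)]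

theorem bigOp_of_newBas_mem {C : Set (T.replace v).Bas} (hC : T.newBas v ∈ C) (x : V) :
    bigOp op C (fun c => some (T.replaceAttr v α x c)) =
      Option.merge op (bigOp op (substSet (C \ {T.newBas v}) ∅) fun a => some (α a)) (some x) := by
  have hn : T.newBas v ∉ C \ {T.newBas v} := fun h => h.2 rfl
  rw [← bigOp_of_newBas_notMem op α hn x, optionMerge_comm]
  conv_lhs => rw [← Set.insert_sdiff_self_of_mem hC, bigOp_insert op hn]
  rfl

/-- The first factor is the one in `bigOp_of_newBas_mem`: replacing the new step by `C'` only
replaces `x` by the combination over `C'`. -/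
theorem bigOp_substSet {C : Set (T.replace v).Bas} (hC : T.newBas v ∈ C)
    (C' : Set (T.sub v).Bas) :
    bigOp op (substSet C C') (fun a => some (α a)) =
      Option.merge op (bigOp op (substSet (C \ {T.newBas v}) ∅) fun a => some (α a))
        (bigOp op C' fun s => some (T.subAttr v α s)) := by
  have hU : substSet C C' = substSet (C \ {T.newBas v}) ∅ ∪ T.subBas v '' C' := by
    ext a
    by_cases ha : T.projBas v a = T.newBas v
    · obtain ⟨s, rfl⟩ := exists_subBas (projBas_eq_newBas_iff.1 ha)
      rw [Set.mem_union, mem_substSet_subBas, mem_substSet_subBas,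
        (T.subBas_injective v).mem_set_image]
      simp [hC]
    · rw [Set.mem_union, mem_substSet_of_ne ha, mem_substSet_of_ne ha]
      constructor
      · exact fun h => Or.inl ⟨h, ha⟩
      · rintro (h | ⟨s, _, rfl⟩)
        · exact h.1
        · simp at ha
  have hD : Disjoint (substSet (C \ {T.newBas v}) ∅) (T.subBas v '' C') := by
    rw [Set.disjoint_left]
    rintro _ h ⟨s, _, rfl⟩
    exact (mem_substSet_subBas.1 h).2
  rw [hU, bigOp_union op hD, bigOp_image op ((T.subBas_injective v).injOn)]
  rfl

end Value

/-! ### Values of the minimal attacks -/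

/-- A metric built from values of minimal attacks can be computed through a module. -/
theorem bigOp_minAttacks (hv : T.IsModule v) (op : V → V → V) [Std.Commutative op]
    [Std.Associative op] (f : T.Attack → Option V) (g : (T.replace v).Attack → Option V)
    (h₁ : ∀ P ∈ (T.replace v).minAttacks, T.newBas v ∈ P.carrier →
      bigOp op (T.sub v).minAttacks (fun Q => f (P.subst Q)) = g P)
    (h₂ : ∀ P ∈ (T.replace v).minAttacks, T.newBas v ∉ P.carrier → f (P.subst ⊥) = g P) :
    bigOp op T.minAttacks f = bigOp op (T.replace v).minAttacks g := by
  rw [bigOp_dependent_pairs op (S₁ := (T.replace v).minAttacks)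
    (K := fun P => {Q : (T.sub v).Attack |
      (T.newBas v ∈ P.carrier → Q ∈ (T.sub v).minAttacks) ∧ (T.newBas v ∉ P.carrier → Q = ⊥)})
    (g := fun P Q => P.subst Q) (r := fun O => O.contract v) (r' := fun O => O.inside v)]
  · refine bigOp_congr op fun P hP => ?_
    by_cases hn : T.newBas v ∈ P.carrier
    · rw [← h₁ P hP hn]
      congr 1
      ext Q
      exact ⟨fun h => h.1 hn, fun h => ⟨fun _ => h, fun h' => absurd hn h'⟩⟩
    · rw [← h₂ P hP hn]
      have : {Q : (T.sub v).Attack | (T.newBas v ∈ P.carrier → Q ∈ (T.sub v).minAttacks) ∧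
          (T.newBas v ∉ P.carrier → Q = ⊥)} = {⊥} := by
        ext Q
        exact ⟨fun h => h.2 hn, fun h => ⟨fun h' => absurd h' hn, fun _ => h⟩⟩
      rw [this, bigOp_singleton]
  · intro O
    rw [mem_minAttacks_iff hv]
    exact exists_congr fun P => and_congr_right fun _ => exists_congr fun Q =>
      and_assoc.symm
  · intro P _ Q hQ
    exact Attack.contract_subst fun h => (reach_of_mem_minAttacks (hQ.1 h)).carrier_nonempty
  · intro P _ Q hQ
    exact Attack.inside_subst hQ.2

theorem minAttacks_nonempty (h : T.Satisfiable) : T.minAttacks.Nonempty := by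
  obtain ⟨O, hO⟩ := h
  obtain ⟨O', _, hO'⟩ := exists_minimal_le_of_wellFoundedLT (fun O => T.Reach O T.root) O hO
  exact ⟨O', hO'⟩

omit [Finite N] in
theorem carrier_nonempty_of_mem_minAttacks {O : T.Attack} (h : O ∈ T.minAttacks) :
    O.carrier.Nonempty :=
  (reach_of_mem_minAttacks h).carrier_nonempty

/-! ### The dynamic metric -/

/-- The value of a single attack in the dynamic metric. -/
noncomputable def Attack.value (O : T.Attack) (D : DynamicAttributeDomain V) (α : T.Bas → V) :
    Option V :=
  bigOp D.conj O.maxChains fun C => bigOp D.seq C fun a => some (α a)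

theorem exists_bigOp_some_eq_some (op : V → V → V) [Std.Commutative op] [Std.Associative op]
    {S : Set T.Bas} (hS : S.Nonempty) (α : T.Bas → V) :
    ∃ x, bigOp op S (fun a => some (α a)) = some x :=
  exists_bigOp_eq_some op hS fun a _ => ⟨α a, rfl⟩

theorem Attack.exists_value_eq_some {O : T.Attack} (hO : O.carrier.Nonempty)
    (D : DynamicAttributeDomain V) (α : T.Bas → V) : ∃ x, O.value D α = some x :=
  exists_bigOp_eq_some D.conj (maxChains_nonempty hO) fun _ hC =>
    exists_bigOp_some_eq_some D.seq (mem_maxChains_iff.1 hC).1 α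

theorem exists_metric_eq_some (h : T.Satisfiable) (D : DynamicAttributeDomain V)
    (α : T.Bas → V) : ∃ x, T.metric D α = some x :=
  exists_bigOp_eq_some D.disj (minAttacks_nonempty h) fun _ hO =>
    Attack.exists_value_eq_some (carrier_nonempty_of_mem_minAttacks hO) D α

/-- A maximal chain through the new step contributes its outer part combined by `seq` with each
maximal chain of `Q`. Distributivity of `seq` over `conj` collects these into the outer part
combined with the value `x` of `Q`. -/
theorem Attack.value_subst {D : DynamicAttributeDomain V} (hD : D.IsSemiring) (α : T.Bas → V)
    {P : (T.replace v).Attack} {Q : (T.sub v).Attack} {x : V}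
    (h : T.newBas v ∈ P.carrier →
      Q.carrier.Nonempty ∧ Q.value D (T.subAttr v α) = some x) :
    (P.subst Q).value D α = P.value D (T.replaceAttr v α x) := by
  unfold Attack.value
  rw [bigOp_dependent_pairs D.conj (S₁ := P.maxChains)
    (K := fun C => {C' : Set (T.sub v).Bas |
      (T.newBas v ∈ C → C' ∈ Q.maxChains) ∧ (T.newBas v ∉ C → C' = ∅)})
    (g := fun C C' => substSet C C') (r := fun S => T.projBas v '' S)
    (r' := fun S => T.subBas v ⁻¹' S)]
  · refine bigOp_congr D.conj fun C hC => ?_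
    by_cases hn : T.newBas v ∈ C
    · have hQ := h ((mem_maxChains_iff.1 hC).2.1.1 hn)
      have hK : {C' : Set (T.sub v).Bas | (T.newBas v ∈ C → C' ∈ Q.maxChains) ∧
          (T.newBas v ∉ C → C' = ∅)} = Q.maxChains := by
        ext C'
        exact ⟨fun h => h.1 hn, fun h => ⟨fun _ => h, fun h' => absurd hn h'⟩⟩
      rw [hK, bigOp_of_newBas_mem D.seq α hn x, ← hQ.2, Attack.value,
        merge_bigOp D.conj hD.1 _ (maxChains_nonempty hQ.1)]
      · exact bigOp_congr D.conj fun C' _ => bigOp_substSet D.seq α hn C'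
      · exact fun C' hC' => exists_bigOp_some_eq_some D.seq (mem_maxChains_iff.1 hC').1 _
    · have hK : {C' : Set (T.sub v).Bas | (T.newBas v ∈ C → C' ∈ Q.maxChains) ∧
          (T.newBas v ∉ C → C' = ∅)} = {∅} := by
        ext C'
        exact ⟨fun h => h.2 hn, fun h => ⟨fun h' => absurd h' hn, fun _ => h⟩⟩
      rw [hK, bigOp_singleton, bigOp_of_newBas_notMem D.seq α hn x]
  · intro S
    rw [mem_maxChains_subst_iff fun hn => (h hn).1]
    exact exists_congr fun C => and_congr_right fun _ => exists_congr fun C' => and_assoc.symm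
  · intro C _ C' hC'
    exact image_substSet fun hn => (mem_maxChains_iff.1 (hC'.1 hn)).1
  · intro C _ C' hC'
    exact preimage_substSet hC'.2

/-- The value of an attack is an affine function of the attribute of each of its steps. -/
theorem Attack.exists_value_replaceAttr_eq {D : DynamicAttributeDomain V} (hD : D.IsSemiring)
    (α : T.Bas → V) {P : (T.replace v).Attack} (hP : T.newBas v ∈ P.carrier) :
    ∃ c d : Option V, ∀ x, P.value D (T.replaceAttr v α x) =
      Option.merge D.conj c (Option.merge D.seq d (some x)) := by
  set M : Set (Set (T.replace v).Bas) := {C | C ∈ P.maxChains ∧ T.newBas v ∈ C}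
  set M' : Set (Set (T.replace v).Bas) := {C | C ∈ P.maxChains ∧ T.newBas v ∉ C}
  have hU : P.maxChains = M' ∪ M := by
    ext C
    by_cases hn : T.newBas v ∈ C <;> simp [M, M', hn]
  have hdis : Disjoint M' M := Set.disjoint_left.2 fun C h h' => h.2 h'.2
  let Y : Set (T.replace v).Bas → Option V := fun C =>
    bigOp D.seq (substSet (C \ {T.newBas v}) ∅) fun a => some (α a)
  have hM : ∀ x, bigOp D.conj M (fun C => bigOp D.seq C fun c => some (T.replaceAttr v α x c)) =
      bigOp D.conj M fun C => Option.merge D.seq (some x) (Y C) := fun x =>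
    bigOp_congr D.conj fun C hC => by
      rw [bigOp_of_newBas_mem D.seq α hC.2 x, optionMerge_comm]
  have hM' : ∀ x, bigOp D.conj M' (fun C => bigOp D.seq C fun c =>
      some (T.replaceAttr v α x c)) =
      bigOp D.conj M' fun C => bigOp D.seq (substSet C ∅) fun a => some (α a) := fun x =>
    bigOp_congr D.conj fun C hC => bigOp_of_newBas_notMem D.seq α hC.2 x
  refine ⟨bigOp D.conj M' fun C => bigOp D.seq (substSet C ∅) fun a => some (α a),
    bigOp D.conj M Y, fun x => ?_⟩
  rw [Attack.value, hU, bigOp_union D.conj hdis, hM, hM']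
  congr 1
  rw [optionMerge_comm D.seq]
  -- If the new step alone is a maximal chain, its outer part is empty and `Y` is `none` there. The
  -- new step is then comparable with nothing, so no other maximal chain contains it, and `d = none`
  -- acts as a unit. Otherwise every `Y C` with `C` in `M` is defined and distributivity applies.
  by_cases hs : {T.newBas v} ∈ P.maxChains
  · have hMs : M = {{T.newBas v}} := by
      ext C
      constructor
      · rintro ⟨hC, hn⟩
        refine Set.Subset.antisymm (fun c hc => ?_) (Set.singleton_subset_iff.2 hn)
        have hC' := (mem_maxChains_iff.1 hC).2.1
        refine (mem_maxChains_iff.1 hs).2.2 c (hC'.1 hc) ?_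
        rintro a rfl hac
        exact hC'.2 _ hn c hc hac
      · rintro rfl
        exact ⟨hs, rfl⟩
    rw [hMs, bigOp_singleton, bigOp_singleton]
  · have hMne : M.Nonempty := by
      obtain ⟨C, hC, hn⟩ := exists_mem_maxChains hP
      exact ⟨C, hC, hn⟩
    rw [merge_bigOp D.conj hD.1 _ hMne]
    intro C hC
    refine exists_bigOp_some_eq_some D.seq ?_ α
    have hn : T.newBas v ∉ C \ {T.newBas v} := fun h => h.2 rfl
    rw [← Set.image_nonempty (f := T.projBas v), image_substSet fun h => absurd h hn,
      Set.nonempty_iff_ne_empty, Ne, Set.sdiff_eq_empty]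
    intro h
    exact hs (Set.Subset.antisymm h (Set.singleton_subset_iff.2 hC.2) ▸ hC.1)

/-- Modular computation of the dynamic metric. -/
theorem metric_eq_metric_replace (hv : T.IsModule v) {D : DynamicAttributeDomain V}
    (hD : D.IsSemiring) (α : T.Bas → V) (hs : (T.sub v).Satisfiable) {x : V}
    (hx : (T.sub v).metric D (T.subAttr v α) = some x) :
    T.metric D α = (T.replace v).metric D (T.replaceAttr v α x) := by
  refine bigOp_minAttacks hv D.disj (fun O => O.value D α)
    (fun P => P.value D (T.replaceAttr v α x)) (fun P _ hn => ?_) (fun P _ hn => ?_)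
  · obtain ⟨c, d, hcd⟩ := Attack.exists_value_replaceAttr_eq hD α hn
    have hval : ∀ Q ∈ (T.sub v).minAttacks, ∃ y, Q.value D (T.subAttr v α) = some y :=
      fun Q hQ => Attack.exists_value_eq_some (carrier_nonempty_of_mem_minAttacks hQ) D _
    have hval' : ∀ Q ∈ (T.sub v).minAttacks,
        ∃ y, Option.merge D.seq d (Q.value D (T.subAttr v α)) = some y := fun Q hQ => by
      obtain ⟨y, hy⟩ := hval Q hQ
      rw [hy]
      cases d <;> simp [Option.merge]
    -- With `x` written as the `disj` over the minimal attacks of `T_v`, this `disj` is pulled out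
    -- first through `seq d` and then through `conj c`; the same `c` and `d` serve for every `Q`.
    rw [hcd, ← hx, AttackTree.metric]
    change _ = Option.merge D.conj c (Option.merge D.seq d
      (bigOp D.disj (T.sub v).minAttacks fun Q => Q.value D (T.subAttr v α)))
    rw [merge_bigOp D.disj hD.2.1 d (minAttacks_nonempty hs) hval,
      merge_bigOp D.disj hD.2.2 c (minAttacks_nonempty hs) hval']
    refine bigOp_congr D.disj fun Q hQ => ?_
    obtain ⟨y, hy⟩ := hval Q hQ
    rw [hy, ← hcd]
    exact Attack.value_subst hD α fun _ => ⟨carrier_nonempty_of_mem_minAttacks hQ, hy⟩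
  · exact Attack.value_subst hD α fun h => absurd h hn

/-! ### The static metric -/

/-- The attack with carrier `A` and the empty order. -/
def Attack.unordered (A : Set T.Bas) : T.Attack where
  carrier := A
  prec _ _ := False
  mem_of_prec _ _ h := h.elim
  irrefl _ h := h
  trans _ _ _ h _ := h

omit [Finite N] in
theorem IsStatic.staticReach_iff (hT : T.IsStatic) (O : T.Attack) (x : N) :
    T.StaticReach O.carrier x ↔ T.Reach O x := by
  constructor
  · intro h
    induction h with
    | bas a ha => exact Reach.bas a ha
    | or x y ht hy _ ih => exact Reach.or x y ht hy ih
    | and x ht _ ih => exact Reach.and x ht ih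
  · intro h
    induction h with
    | bas a ha => exact StaticReach.bas a ha
    | or x y ht hy _ ih => exact StaticReach.or x y ht hy ih
    | and x ht _ ih => exact StaticReach.and x ht ih
    | sand x ht => exact absurd ht (hT x)

omit [Finite N] in
-- Without SAND gates the order plays no role in reaching a node, so minimality removes it.
theorem IsStatic.eq_unordered (hT : T.IsStatic) {O : T.Attack} (hO : O ∈ T.minAttacks) :
    O = Attack.unordered O.carrier := by
  have hle : Attack.unordered O.carrier ≤ O := ⟨subset_rfl, fun _ _ h => h.elim⟩
  refine le_antisymm (le_of_mem_minAttacks hO ?_ hle) hle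
  exact (hT.staticReach_iff (Attack.unordered O.carrier) _).1
    ((hT.staticReach_iff O _).2 (reach_of_mem_minAttacks hO))

omit [Finite N] in
theorem IsStatic.staticMinAttacks_eq (hT : T.IsStatic) :
    T.staticMinAttacks = Attack.carrier '' T.minAttacks := by
  ext A
  constructor
  · intro hA
    have hA' : Minimal (fun A' => T.StaticReach A' T.root) A := hA
    refine ⟨Attack.unordered A, ⟨?_, fun O hO hle => ⟨?_, fun _ _ h => h.elim⟩⟩, rfl⟩
    · exact (hT.staticReach_iff (Attack.unordered A) _).1 hA'.prop
    · exact hA'.le_of_le ((hT.staticReach_iff O _).2 hO) hle.1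
  · rintro ⟨O, hO, rfl⟩
    refine ⟨(hT.staticReach_iff O _).2 (reach_of_mem_minAttacks hO), fun A hA hle => ?_⟩
    exact (le_of_mem_minAttacks hO (O' := Attack.unordered A)
      ((hT.staticReach_iff (Attack.unordered A) _).1 hA) ⟨hle, fun _ _ h => h.elim⟩).1

/-- Minimal attacks with empty order are determined by their carriers. This makes `bigOp_minAttacks`
available for the static metric too. -/
theorem IsStatic.staticMetric_eq (hT : T.IsStatic) (D : AttributeDomain V) (α : T.Bas → V) :
    T.staticMetric D α = bigOp D.disj T.minAttacks fun O =>
      bigOp D.conj O.carrier fun a => some (α a) := by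
  rw [staticMetric, hT.staticMinAttacks_eq, bigOp_image]
  intro O hO O' hO' h
  rw [hT.eq_unordered hO, hT.eq_unordered hO', h]

theorem IsStatic.satisfiable (hT : T.IsStatic) : T.Satisfiable := by
  refine ⟨Attack.unordered Set.univ, ?_⟩
  suffices ∀ x, T.Reach (Attack.unordered Set.univ) x from this _
  intro x
  induction x using T.wellFounded_child.induction with
  | _ x ih =>
    cases ht : T.typ x with
    | bas => exact (reach_iff_of_bas ht).2 trivial
    | or =>
      obtain ⟨y, hy⟩ := ch_ne_nil (T := T) (x := x) (by simp [ht])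
      exact Reach.or x y ht hy (ih y hy)
    | and => exact Reach.and x ht ih
    | sand => exact absurd ht (hT x)

omit [Finite N] in
theorem IsStatic.sub (hT : T.IsStatic) (v : N) : (T.sub v).IsStatic := fun x => hT x.1

theorem IsStatic.replace (hT : T.IsStatic) (v : N) : (T.replace v).IsStatic := by
  rintro (_ | x)
  · exact fun h => NodeType.noConfusion h
  · exact hT x.1

theorem IsStatic.exists_staticMetric_eq_some (hT : T.IsStatic) (D : AttributeDomain V)
    (α : T.Bas → V) : ∃ x, T.staticMetric D α = some x := by
  rw [hT.staticMetric_eq]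
  exact exists_bigOp_eq_some D.disj (minAttacks_nonempty hT.satisfiable) fun _ hO =>
    exists_bigOp_some_eq_some D.conj (carrier_nonempty_of_mem_minAttacks hO) α

/-- Modular computation of the static metric. -/
theorem staticMetric_eq_staticMetric_replace (hv : T.IsModule v) (hT : T.IsStatic)
    {D : AttributeDomain V} (hD : D.IsSemiring) (α : T.Bas → V) {x : V}
    (hx : (T.sub v).staticMetric D (T.subAttr v α) = some x) :
    T.staticMetric D α = (T.replace v).staticMetric D (T.replaceAttr v α x) := by
  rw [hT.staticMetric_eq, (hT.replace v).staticMetric_eq]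
  rw [(hT.sub v).staticMetric_eq] at hx
  refine bigOp_minAttacks hv D.disj _ _ (fun P _ hn => ?_) (fun P _ hn => ?_)
  · rw [bigOp_of_newBas_mem D.conj α hn, ← hx, merge_bigOp D.disj hD _
      (minAttacks_nonempty (hT.sub v).satisfiable) fun Q hQ =>
        exists_bigOp_some_eq_some D.conj (carrier_nonempty_of_mem_minAttacks hQ) _]
    exact bigOp_congr D.disj fun Q _ => bigOp_substSet D.conj α hn Q.carrier
  · exact (bigOp_of_newBas_notMem D.conj α hn x).symm

end AttackTree

/-! ### Both modular decompositions, with definedness of the metrics. -/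

theorem mainTheorem3 {N : Type u} [Finite N] {V : Type w} (T : AttackTree N) (v : N)
    (hv : T.IsModule v) (α : T.Bas → V) :
    (T.IsStatic → ∀ D : AttributeDomain V, D.IsSemiring →
      ∃ x y : V, (T.sub v).staticMetric D (T.subAttr v α) = some x ∧
        T.staticMetric D α = some y ∧
        (T.replace v).staticMetric D (T.replaceAttr v α x) = some y) ∧
    (T.Satisfiable → (T.sub v).Satisfiable →
      ∀ D : DynamicAttributeDomain V, D.IsSemiring →
      ∃ x y : V, (T.sub v).metric D (T.subAttr v α) = some x ∧
        T.metric D α = some y ∧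
        (T.replace v).metric D (T.replaceAttr v α x) = some y) := by
  constructor
  · intro hT D hD
    obtain ⟨x, hx⟩ := (hT.sub v).exists_staticMetric_eq_some D (T.subAttr v α)
    obtain ⟨y, hy⟩ := hT.exists_staticMetric_eq_some D α
    exact ⟨x, y, hx, hy,
      (AttackTree.staticMetric_eq_staticMetric_replace hv hT hD α hx).symm.trans hy⟩
  · intro hT hTv D hD
    obtain ⟨x, hx⟩ := AttackTree.exists_metric_eq_some hTv D (T.subAttr v α)
    obtain ⟨y, hy⟩ := AttackTree.exists_metric_eq_some hT D α
    exact ⟨x, y, hx, hy, (AttackTree.metric_eq_metric_replace hv hD α hTv hx).symm.trans hy⟩
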